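/- All languages are many-sorted, and all sorts of a structure are nonempty. Let $\widetilde{L}$ be a language and $L\subseteq\widetilde{L}$ a sublanguage (possibly with fewer sorts). Let $T$ be an NIP $L$-theory that eliminates imaginaries, and let $\widetilde{T}\supseteq T$ be a complete $\widetilde{L}$-theory. For a subset $A$ of an $L$-structure $M$, say that $A$ is *uniformly stably embedded* in $M$ if for every $L$-formula $\varphi(x;t)$ there is an $L$-formula $\chi(x;s)$ such that for every tuple $b$ in $M$ there is a tuple $a$ in $A$ with $\varphi(A,b)=\chi(A,a)$. Suppose that there is a model $M\models\widetilde{T}$ whose reduct $M|_L$ is uniformly stably embedded in each of its elementary extensions (as an $L$-structure). Let $\varphi(x;t)$ be an $L$-formula, let $N\models\widetilde{T}$, let $A\subseteq N^{\mathrm{eq}}$ satisfy $A=\mathrm{dcl}^{\mathrm{eq}}_{\widetilde{L}}(A)$ (where $N^{\mathrm{eq}}$ is formed in the language $\widetilde{L}$), and let $p$ be a complete $\varphi$-type over $N$ in the variables $x$, that is, a maximal set of formulas $\varphi(x;m)$ and $\neg\varphi(x;m)$, $m$ a tuple in $N$, that is finitely satisfiable in $N$. Let $\mathcal{R}(A)$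 denote the set of the elements of $A$ that belong to one of the sorts of $L$. If $p$ is $\widetilde{L}^{\mathrm{eq}}(A)$-definable, meaning that the set $\{m : \varphi(x;m)\in p\}$ is definable in $N^{\mathrm{eq}}$ by an $\widetilde{L}^{\mathrm{eq}}$-formula with parameters from $A$, then $p$ is $L(\mathcal{R}(A))$-definable, meaning that $\{m : \varphi(x;m)\in p\}$ is definable in $N|_L$ by an $L$-formula with parameters from $\mathcal{R}(A)$. -/

import Mathlib

/-! Many-sorted first-order logic, imaginaries, and the model-theoretic notions built on them. -/

universe u

namespace ManySorted

/-! ### Syntax -/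

/-- A many-sorted first-order language. Every function symbol `f` has a finite tuple `funDom f` of
argument sorts and a value sort `funCod f`; every relation symbol `R` has a finite tuple `relDom R`
of argument sorts. Constants are function symbols of arity `0`. -/
structure Language where
  Sorts : Type u
  Functions : Type u
  Relations : Type u
  funArity : Functions → ℕ
  funDom : (f : Functions) → Fin (funArity f) → Sorts
  funCod : Functions → Sorts
  relArity : Relations → ℕ
  relDom : (R : Relations) → Fin (relArity R) → Sorts

namespace Language

/-- Terms of a given sort, in variables indexed by `α`, where the variable `i` has sort `v i`. -/
inductive Term (L : Language.{u}) {α : Type} (v : α → L.Sorts) : L.Sorts → Type u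
  | var (i : α) : Term L v (v i)
  | app (f : L.Functions) (ts : (i : Fin (L.funArity f)) → Term L v (L.funDom f i)) :
      Term L v (L.funCod f)

/-- Formulas with free variables indexed by `α` (the variable `i` having sort `v i`), and further
(de Bruijn) variables whose sorts are listed by `Γ`. -/
inductive BoundedFormula (L : Language.{u}) {α : Type} (v : α → L.Sorts) :
    List L.Sorts → Type u
  | falsum {Γ : List L.Sorts} : BoundedFormula L v Γ
  | equal {Γ : List L.Sorts} {s : L.Sorts} (t₁ t₂ : L.Term (Sum.elim v Γ.get) s) :
      BoundedFormula L v Γ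
  | rel {Γ : List L.Sorts} (R : L.Relations)
      (ts : (i : Fin (L.relArity R)) → L.Term (Sum.elim v Γ.get) (L.relDom R i)) :
      BoundedFormula L v Γ
  | imp {Γ : List L.Sorts} (φ ψ : BoundedFormula L v Γ) : BoundedFormula L v Γ
  | all {Γ : List L.Sorts} (s : L.Sorts) (φ : BoundedFormula L v (s :: Γ)) :
      BoundedFormula L v Γ

/-- Formulas whose free variables are indexed by `α`, the variable `i` having sort `v i`.
A formula `φ(x; t)` is one whose variables are indexed by a disjoint sum. -/
abbrev Formula (L : Language.{u}) {α : Type} (v : α → L.Sorts) : Type u :=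
  L.BoundedFormula v []

/-- Formulas without free variables. -/
abbrev Sentence (L : Language.{u}) : Type u :=
  L.Formula (Empty.elim : Empty → L.Sorts)

/-- A theory is a set of sentences. -/
abbrev Theory (L : Language.{u}) : Type u := Set L.Sentence

end Language

/-! ### Semantics -/

/-- Structures for a many-sorted language. As usual, every sort has a nonempty domain. -/
structure Structure (L : Language.{u}) where
  carrier : L.Sorts → Type u
  nonempty : ∀ s, Nonempty (carrier s)
  funMap : (f : L.Functions) → ((i : Fin (L.funArity f)) → carrier (L.funDom f i)) →
    carrier (L.funCod f)
  relMap : (R : L.Relations) → ((i : Fin (L.relArity R)) → carrier (L.relDom R i)) → Prop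

/-- Tuples of elements of `M` indexed by `α`, the `i`-th entry being of sort `v i`. -/
abbrev Tuple {L : Language.{u}} (M : Structure L) {α : Type} (v : α → L.Sorts) : Type u :=
  (i : α) → M.carrier (v i)

/-- Concatenation of two tuples. -/
def Tuple.append {L : Language.{u}} {M : Structure L} {α β : Type} {v : α → L.Sorts}
    {w : β → L.Sorts} (x : Tuple M v) (y : Tuple M w) : Tuple M (Sum.elim v w)
  | Sum.inl i => x i
  | Sum.inr j => y j

/-- Adding an element in front of a tuple. -/
def Tuple.cons {L : Language.{u}} {M : Structure L} {s : L.Sorts} {Γ : List L.Sorts}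
    (a : M.carrier s) (b : Tuple M Γ.get) : Tuple M (s :: Γ).get :=
  Fin.cases (motive := fun i => M.carrier ((s :: Γ).get i)) a b

namespace Language

/-- The value of a term at a tuple. -/
def Term.eval {L : Language.{u}} (M : Structure L) {α : Type} {v : α → L.Sorts}
    (x : Tuple M v) : {s : L.Sorts} → L.Term v s → M.carrier s
  | _, .var i => x i
  | _, .app f ts => M.funMap f (fun i => (ts i).eval M x)

/-- Truth of a formula in `M`, where `x` interprets the free variables and `b` the variables
listed by `Γ`. -/
def BoundedFormula.Realize {L : Language.{u}} (M : Structure L) {α : Type} {v : α → L.Sorts} :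
    {Γ : List L.Sorts} → L.BoundedFormula v Γ → Tuple M v → Tuple M Γ.get → Prop
  | _, .falsum, _, _ => False
  | _, .equal t₁ t₂, x, b => t₁.eval M (x.append b) = t₂.eval M (x.append b)
  | _, .rel R ts, x, b => M.relMap R (fun i => (ts i).eval M (x.append b))
  | _, .imp φ ψ, x, b => φ.Realize M x b → ψ.Realize M x b
  | _, .all s φ, x, b => ∀ a : M.carrier s, φ.Realize M x (b.cons a)

/-- `φ.Holds M x` means `M ⊨ φ(x)`. -/
def Formula.Holds {L : Language.{u}} {α : Type} {v : α → L.Sorts} (φ : L.Formula v)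
    (M : Structure L) (x : Tuple M v) : Prop :=
  BoundedFormula.Realize M φ x (fun i => i.elim0)

/-- `φ.Holds₂ M x y` means `M ⊨ φ(x; y)`. -/
def Formula.Holds₂ {L : Language.{u}} {α β : Type} {v : α → L.Sorts} {w : β → L.Sorts}
    (φ : L.Formula (Sum.elim v w)) (M : Structure L) (x : Tuple M v) (y : Tuple M w) : Prop :=
  Formula.Holds φ M (x.append y)

/-- Truth of a sentence in `M`. -/
def Sentence.True {L : Language.{u}} (φ : L.Sentence) (M : Structure L) : Prop :=
  Formula.Holds φ M (fun i => i.elim)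

/-- `M` is a model of `T`. -/
def Theory.IsModel {L : Language.{u}} (T : L.Theory) (M : Structure L) : Prop :=
  ∀ φ ∈ T, Sentence.True φ M

/-- `T` is complete: it has a model, and it entails each sentence or its negation. -/
def Theory.IsComplete {L : Language.{u}} (T : L.Theory) : Prop :=
  (∃ M : Structure L, T.IsModel M) ∧
    ∀ φ : L.Sentence,
      (∀ M : Structure L, T.IsModel M → Sentence.True φ M) ∨
        (∀ M : Structure L, T.IsModel M → ¬ Sentence.True φ M)

end Language

/-- Elementary embeddings. -/
structure ElementaryEmbedding {L : Language.{u}} (M N : Structure L) where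
  toFun : (s : L.Sorts) → M.carrier s → N.carrier s
  holds_iff : ∀ {n : ℕ} (σ : Fin n → L.Sorts) (φ : L.Formula σ) (x : Tuple M σ),
    φ.Holds N (fun i => toFun (σ i) (x i)) ↔ φ.Holds M x

/-- The image of an elementary embedding, as a sorted subset. -/
def ElementaryEmbedding.range {L : Language.{u}} {M N : Structure L}
    (j : ElementaryEmbedding M N) : (s : L.Sorts) → Set (N.carrier s) :=
  fun s => Set.range (j.toFun s)

/-! ### Definability -/

/-- `X` is definable in `M` by a formula with parameters from the sorted subset `A`. -/
def Definable {L : Language.{u}} (M : Structure L) (A : (s : L.Sorts) → Set (M.carrier s))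
    {n : ℕ} (σ : Fin n → L.Sorts) (X : Set (Tuple M σ)) : Prop :=
  ∃ (k : ℕ) (ρ : Fin k → L.Sorts) (ψ : L.Formula (Sum.elim σ ρ)) (a : Tuple M ρ),
    (∀ i, a i ∈ A (ρ i)) ∧ X = {x | ψ.Holds₂ M x a}

/-- The definable closure of `A` in `M`: the elements `e` such that `{e}` is definable over `A`. -/
def dcl {L : Language.{u}} (M : Structure L) (A : (s : L.Sorts) → Set (M.carrier s)) :
    (s : L.Sorts) → Set (M.carrier s) :=
  fun s => {e | Definable M A (fun _ : Fin 1 => s) {x | x 0 = e}}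

/-- The sorted subset `A` is uniformly stably embedded in `M`: for all formulas `φ(x; t)` there is
a formula `χ(x; r)` such that for all tuples `b` in `M` there is a tuple `a` in `A` with
`φ(A; b) = χ(A; a)`. -/
def UniformlyStablyEmbedded {L : Language.{u}} (M : Structure L)
    (A : (s : L.Sorts) → Set (M.carrier s)) : Prop :=
  ∀ {n m : ℕ} (σ : Fin n → L.Sorts) (τ : Fin m → L.Sorts) (φ : L.Formula (Sum.elim σ τ)),
    ∃ (k : ℕ) (ρ : Fin k → L.Sorts) (χ : L.Formula (Sum.elim σ ρ)),
      ∀ b : Tuple M τ, ∃ a : Tuple M ρ, (∀ i, a i ∈ A (ρ i)) ∧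
        ∀ x : Tuple M σ, (∀ i, x i ∈ A (σ i)) → (φ.Holds₂ M x b ↔ χ.Holds₂ M x a)

/-! ### NIP and elimination of imaginaries -/

/-- `T` is NIP: in each model `M`, each formula `φ(x; t)` has finite VC-dimension, that is, for some
`k` no `k` tuples `a₀, …, aₖ₋₁` are shattered by the family of sets `φ(M; b)`. -/
def Language.Theory.IsNIP {L : Language.{u}} (T : L.Theory) : Prop :=
  ∀ M : Structure L, T.IsModel M →
    ∀ {n m : ℕ} (σ : Fin n → L.Sorts) (τ : Fin m → L.Sorts) (φ : L.Formula (Sum.elim σ τ)),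
      ∃ k : ℕ, ¬ ∃ a : Fin k → Tuple M σ,
        ∀ I : Set (Fin k), ∃ b : Tuple M τ, ∀ i, φ.Holds₂ M (a i) b ↔ i ∈ I

/-- `T` eliminates imaginaries: in each model `M`, each class `{x | E(x, a)}` of each
equivalence relation `E` definable without parameters on tuples is coded by a finite tuple of `M`,
that is, for some formula `ψ(x; z)` there is exactly one tuple `e` such that `ψ(x; e)` defines the
class. -/
def Language.Theory.EliminatesImaginaries {L : Language.{u}} (T : L.Theory) : Prop :=
  ∀ M : Structure L, T.IsModel M →
    ∀ {n : ℕ} (σ : Fin n → L.Sorts) (E : L.Formula (Sum.elim σ σ)),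
      Equivalence (fun x y : Tuple M σ => E.Holds₂ M x y) →
      ∀ a : Tuple M σ,
        ∃ (k : ℕ) (ρ : Fin k → L.Sorts) (ψ : L.Formula (Sum.elim σ ρ)),
          ∃! e : Tuple M ρ, {x : Tuple M σ | ψ.Holds₂ M x e} = {x | E.Holds₂ M x a}

/-! ### Sublanguages and reducts -/

/-- A language contained in `L`: a set of sorts, of function symbols and of relation symbols of `L`
such that the sorts of the chosen symbols are chosen. -/
structure Sublanguage (L : Language.{u}) where
  sorts : Set L.Sorts
  functions : Set L.Functions
  relations : Set L.Relations
  funDom_mem : ∀ f ∈ functions, ∀ i, L.funDom f i ∈ sorts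
  funCod_mem : ∀ f ∈ functions, L.funCod f ∈ sorts
  relDom_mem : ∀ R ∈ relations, ∀ i, L.relDom R i ∈ sorts

/-- A sublanguage as a language in its own right. -/
abbrev Sublanguage.toLanguage {L : Language.{u}} (K : Sublanguage L) : Language.{u} where
  Sorts := K.sorts
  Functions := K.functions
  Relations := K.relations
  funArity f := L.funArity f.1
  funDom f i := ⟨L.funDom f.1 i, K.funDom_mem f.1 f.2 i⟩
  funCod f := ⟨L.funCod f.1, K.funCod_mem f.1 f.2⟩
  relArity R := L.relArity R.1
  relDom R i := ⟨L.relDom R.1 i, K.relDom_mem R.1 R.2 i⟩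

/-- The reduct of a structure to a sublanguage. -/
abbrev Structure.reduct {L : Language.{u}} (M : Structure L) (K : Sublanguage L) :
    Structure K.toLanguage where
  carrier s := M.carrier s.1
  nonempty s := M.nonempty s.1
  funMap f x := M.funMap f.1 x
  relMap R x := M.relMap R.1 x

/-! ### Imaginaries -/

/-- The equivalence relations on tuples of `M` that are definable without parameters, each
given by a formula `E(x, y)` defining it. When `M` is a model of a complete theory, which formulas
occur depends only on that theory. -/
structure DefEquiv {L : Language.{u}} (M : Structure L) where
  arity : ℕ
  dom : Fin arity → L.Sorts
  rel : L.Formula (Sum.elim dom dom)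
  equiv : Equivalence (fun x y : Tuple M dom => rel.Holds₂ M x y)

/-- The setoid of a definable equivalence relation. -/
def DefEquiv.setoid {L : Language.{u}} {M : Structure L} (E : DefEquiv M) :
    Setoid (Tuple M E.dom) :=
  ⟨fun x y => E.rel.Holds₂ M x y, E.equiv⟩

/-- The language `L^eq` of `M^eq`: the language `L` together with a new sort for each definable
equivalence relation `E`, and a symbol for the projection from tuples onto the sort of `E`. -/
abbrev Structure.eqLanguage {L : Language.{u}} (M : Structure L) : Language.{u} where
  Sorts := L.Sorts ⊕ DefEquiv M
  Functions := L.Functions ⊕ DefEquiv M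
  Relations := L.Relations
  funArity
    | Sum.inl f => L.funArity f
    | Sum.inr E => E.arity
  funDom
    | Sum.inl f => fun i => Sum.inl (L.funDom f i)
    | Sum.inr E => fun i => Sum.inl (E.dom i)
  funCod
    | Sum.inl f => Sum.inl (L.funCod f)
    | Sum.inr E => Sum.inr E
  relArity := L.relArity
  relDom R i := Sum.inl (L.relDom R i)

/-- The structure `M^eq`. Its sorts are those of `M` and the quotients of sets of tuples of `M` by
definable equivalence relations. -/
abbrev Structure.eq {L : Language.{u}} (M : Structure L) : Structure M.eqLanguage where
  carrier
    | Sum.inl s => M.carrier s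
    | Sum.inr E => Quotient E.setoid
  nonempty
    | Sum.inl s => M.nonempty s
    | Sum.inr E => ⟨Quotient.mk E.setoid (fun i => (M.nonempty (E.dom i)).some)⟩
  funMap
    | Sum.inl f => fun x => M.funMap f x
    | Sum.inr E => fun x => Quotient.mk E.setoid x
  relMap R x := M.relMap R x

/-- For a subset `A` of `M^eq`, the set of the elements of `A` that belong to a sort of the
sublanguage `K`, as a subset of the reduct of `M` to `K`. -/
def realPart {L : Language.{u}} {M : Structure L} (K : Sublanguage L)
    (A : (s : M.eqLanguage.Sorts) → Set (M.eq.carrier s)) :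
    (s : K.toLanguage.Sorts) → Set ((M.reduct K).carrier s) :=
  fun s => A (Sum.inl s.1)

/-! ### `φ`-types -/

/-- A complete `φ`-type over `M` in the variables `x`, where `φ` is `φ(x; t)`. The pair `(b, True)`
stands for the formula `φ(x; b)`, the pair `(b, False)` for `¬ φ(x; b)`; consistency with the
elementary diagram of `M` is finite satisfiability in `M`. -/
structure PhiType {L : Language.{u}} (M : Structure L) {n m : ℕ} {σ : Fin n → L.Sorts}
    {τ : Fin m → L.Sorts} (φ : L.Formula (Sum.elim σ τ)) where
  formulas : Set (Tuple M τ × Prop)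
  complete : ∀ b : Tuple M τ, (b, True) ∈ formulas ∨ (b, False) ∈ formulas
  consistent : ∀ F ⊆ formulas, F.Finite →
    ∃ a : Tuple M σ, ∀ f ∈ F, (φ.Holds₂ M a f.1 ↔ f.2)

/-- The set of all `b` in `M` with `φ(x; b) ∈ p`. The `φ`-type `p` is definable over some parameters
when this set is. -/
def PhiType.defSet {L : Language.{u}} {M : Structure L} {n m : ℕ} {σ : Fin n → L.Sorts}
    {τ : Fin m → L.Sorts} {φ : L.Formula (Sum.elim σ τ)} (p : PhiType M φ) :
    Set (Tuple M τ) :=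
  {b | (b, True) ∈ p.formulas}

end ManySorted

/-! Let D be the set of all m with φ(x; m) ∈ p. The proof first defines D by an L-formula with
arbitrary parameters from N, and then uses elimination of imaginaries to replace these parameters by
elements of A.

For the first half, work in the model M whose L-reduct is uniformly stably embedded. Call a set Z of
t-tuples d-consistent if some φ(x; ·) agrees with Z on any d given points. NIP enters through
`exists_separation_bound`: for suitable d and l depending only on φ, if Z is d-consistent and F is
finite, then l tuples x_i can be chosen so that each pair t ∈ Z ∩ F, t' ∈ F \ Z is separated by some
φ(x_i; ·). This follows from the ε-net theorem, used once for φ and once for pairs of points, with a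
minimax argument in between. Consequently, if Z is nonempty, all the sets Z ∩ F are traces of
instances of one L-formula. In an ultrapower of the reduct of M these instances merge into a single
one whose trace on M is Z. Uniform stable embeddedness then makes Z itself an instance of an
L-formula χ that depends only on φ (`exists_uniform_definition_of_consistent`).

Since d is fixed, "every nonempty d-consistent set θ(·; a) is an instance of χ" is a first-order
sentence for each formula θ of the big language. It passes from M to N by completeness and applies
to the θ that defines D (`exists_reduct_definition`). So D = χ(N; b) for some b.

For the second half, the set of all b' with χ(N; b') = D is an L-definable class with a code e in
the sorts of L. It depends only on D, so e lies in the definable closure of A, which is A. Finally D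
is L-definable from e. -/

namespace NIPCombinatorics

open Finset

/-! ### Traces, double sampling and the ε-net theorem -/

/-- The family `R` of sets shatters some `d` points. -/
def ShattersTuple {X : Type*} {ι : Type*} (R : ι → X → Prop) (d : ℕ) : Prop :=
  ∃ a : Fin d → X, ∀ I : Set (Fin d), ∃ b, ∀ i, R b (a i) ↔ i ∈ I

/-- A polynomial bound for the number of traces on a finite set (Sauer–Shelah). -/
theorem card_le_of_not_shatters {V : Type*} [Fintype V] [DecidableEq V]
    (𝒯 : Finset (Finset V)) (d : ℕ) (h : ∀ S : Finset V, 𝒯.Shatters S → #S < d) :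
    #𝒯 ≤ d * (Fintype.card V + 1) ^ d := by
  classical
  calc #𝒯 ≤ #𝒯.shatterer := card_le_card_shatterer 𝒯
    _ ≤ #((range d).biUnion fun k => powersetCard k (univ : Finset V)) := by
        refine card_le_card fun S hS => ?_
        simp only [mem_biUnion, mem_range, mem_powersetCard]
        exact ⟨#S, h S (mem_shatterer.1 hS), subset_univ _, rfl⟩
    _ ≤ ∑ k ∈ range d, #(powersetCard k (univ : Finset V)) := card_biUnion_le
    _ ≤ ∑ _k ∈ range d, (Fintype.card V + 1) ^ d := by
        refine sum_le_sum fun k hk => ?_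
        rw [card_powersetCard, card_univ]
        calc (Fintype.card V).choose k ≤ (Fintype.card V) ^ k := Nat.choose_le_pow _ _
          _ ≤ (Fintype.card V + 1) ^ k := Nat.pow_le_pow_left (Nat.le_succ _) _
          _ ≤ _ := Nat.pow_le_pow_right (Nat.succ_pos _) (mem_range.1 hk).le
    _ = _ := by simp

/-- With m = N * c and N > 2 / ε, the term c is below half of m * ε, and for large c the factor 2 ^
c beats the polynomial enough to put the other term below the other half. The left side will bound
the expected number of hits in the double sampling argument. -/
theorem exists_sample_sizes (d : ℕ) {ε : ℝ} (hε : 0 < ε) :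
    ∃ m c : ℕ, (c : ℝ) + m * (d * (2 * m + 1) ^ d / 2 ^ c) < m * ε := by
  obtain ⟨N, hN⟩ := exists_nat_gt (max 1 (2 / ε))
  have hN1 : (1 : ℝ) < N := lt_of_le_of_lt (le_max_left _ _) hN
  have hN2 : 2 / ε < N := lt_of_le_of_lt (le_max_right _ _) hN
  have hlim := (tendsto_pow_const_div_const_pow_of_one_lt d
    (one_lt_two : (1 : ℝ) < 2)).const_mul (d * (3 * N : ℝ) ^ d)
  rw [mul_zero] at hlim
  obtain ⟨c, hc, hc1⟩ := ((hlim.eventually (gt_mem_nhds (half_pos hε))).and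
    (Filter.eventually_ge_atTop 1)).exists
  have hc1' : (1 : ℝ) ≤ c := by exact_mod_cast hc1
  refine ⟨N * c, c, ?_⟩
  push_cast
  have h1 : (d * (2 * (N * c) + 1) ^ d / 2 ^ c : ℝ) ≤ d * (3 * N : ℝ) ^ d * (c ^ d / 2 ^ c) := by
    have : (2 * (N * c) + 1 : ℝ) ≤ 3 * N * c := by nlinarith
    calc (d * (2 * (N * c) + 1) ^ d / 2 ^ c : ℝ) ≤ d * (3 * N * c) ^ d / 2 ^ c := by gcongr
      _ = _ := by rw [mul_pow]; ring
  have h2 : (c : ℝ) < N * c * (ε / 2) := by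
    rw [div_lt_iff₀ hε] at hN2
    nlinarith
  have h3 : (N * c : ℝ) * (d * (2 * (N * c) + 1) ^ d / 2 ^ c) ≤ N * c * (ε / 2) :=
    mul_le_mul_of_nonneg_left (h1.trans hc.le) (by positivity)
  linarith

/-- The expectation of a function of one coordinate of a random sample. -/
theorem sum_prod_mul_apply {X : Type*} [Fintype X] {m : ℕ} (w : X → ℝ) (hw : ∑ x, w x = 1)
    (j : Fin m) (g : X → ℝ) :
    ∑ s : Fin m → X, (∏ i, w (s i)) * g (s j) = ∑ x, w x * g x := by
  classical
  -- Once `g` is absorbed into the factor at `j`, the sum over samples splits into a product over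
  -- coordinates, and all factors but the one at `j` are 1.
  have h1 : ∀ s : Fin m → X, (∏ i, w (s i)) * g (s j) =
      ∏ i, (w (s i) * if i = j then g (s i) else 1) := by
    intro s
    rw [prod_mul_distrib, prod_ite_eq' univ j (fun i => g (s i))]
    simp
  simp_rw [h1]
  rw [← Fintype.piFinset_univ,
    ← prod_univ_sum (fun _ => univ) (fun i x => w x * if i = j then g x else 1),
    prod_eq_single j]
  · simp
  · intro i _ hij
    simp [hij, hw]
  · simp

theorem sum_prod_eq_one {X : Type*} [Fintype X] {m : ℕ} (w : X → ℝ) (hw : ∑ x, w x = 1) :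
    ∑ s : Fin m → X, (∏ i, w (s i)) = 1 := by
  classical
  rw [← Fintype.piFinset_univ, ← prod_univ_sum]
  simp [hw]

/-- Few sign vectors avoid a set that meets many of the pairs `{(i, false), (i, true)}`. -/
theorem card_avoiding_le {m c : ℕ} (T : Finset (Fin m × Bool)) :
    #{σ : Fin m → Bool | (∀ i, (i, σ i) ∉ T) ∧ c ≤ #{i | (i, !σ i) ∈ T}} * 2 ^ c ≤ 2 ^ m := by
  classical
  set G : Finset (Fin m → Bool) :=
    {σ : Fin m → Bool | (∀ i, (i, σ i) ∉ T) ∧ c ≤ #{i | (i, !σ i) ∈ T}} with hG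
  rcases G.eq_empty_or_nonempty with h0 | ⟨σ₀, hσ₀⟩
  · simp [h0]
  set J : Finset (Fin m) := {i | (i, !σ₀ i) ∈ T} with hJ
  have hcJ : c ≤ #J := by
    have := hσ₀
    rw [hG, mem_filter] at this
    exact this.2.2
  -- For i ∈ J the point of the pair not chosen by `σ₀` lies in `T`. A vector avoiding `T` must
  -- therefore agree with `σ₀` on J, which leaves at most m - c free coordinates.
  have hagree : ∀ σ ∈ G, ∀ i ∈ J, σ i = σ₀ i := by
    intro σ hσ i hi
    rw [hG, mem_filter] at hσ
    rw [hJ, mem_filter] at hi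
    by_contra hne
    have : σ i = !σ₀ i := by revert hne; cases σ i <;> cases σ₀ i <;> simp
    exact hσ.2.1 i (this ▸ hi.2)
  have hinj : #G ≤ Fintype.card ({i // i ∉ J} → Bool) := by
    rw [← card_univ]
    refine card_le_card_of_injOn (fun σ i => σ i.1) (by simp) ?_
    intro σ hσ σ' hσ' h
    funext i
    by_cases hi : i ∈ J
    · rw [hagree σ hσ i hi, hagree σ' hσ' i hi]
    · exact congrFun h ⟨i, hi⟩
  have hcard : Fintype.card ({i // i ∉ J} → Bool) = 2 ^ (m - #J) := by
    simp [Fintype.card_subtype_compl]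
  have hJm : #J ≤ m := by simpa using card_le_univ J
  calc #G * 2 ^ c ≤ 2 ^ (m - #J) * 2 ^ #J :=
        Nat.mul_le_mul (hcard ▸ hinj) (Nat.pow_le_pow_right two_pos hcJ)
    _ = 2 ^ m := by rw [← pow_add, Nat.sub_add_cancel hJm]

/-- Swapping the coordinates of the pairs selected by `σ`. -/
def swapPairs {X : Type*} {m : ℕ} (σ : Fin m → Bool) : (Fin m → X × X) ≃ (Fin m → X × X) where
  toFun f i := bif σ i then (f i).swap else f i
  invFun f i := bif σ i then (f i).swap else f i
  left_inv f := by funext i; dsimp only; cases σ i <;> simp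
  right_inv f := by funext i; dsimp only; cases σ i <;> simp

/-- The averaged number of hits in the second half of a sample by a set that misses
the first half. -/
theorem sum_swap_le {X ι : Type*} [Fintype X] {d m c : ℕ} (R : ι → X → Prop)
    (hR : ¬ ShattersTuple R d) (B : (Fin m → X) → ι)
    (hB : ∀ s i, ¬ R (B s) (s i)) (f : Fin m → X × X) (h : (Fin m → X × X) → ℕ)
    (hh : ∀ f, h f = Nat.card {i // R (B fun i => (f i).1) (f i).2}) :
    (∑ σ : Fin m → Bool, (h (swapPairs σ f) : ℝ)) ≤
      2 ^ m * (c + m * (d * (2 * m + 1) ^ d / 2 ^ c)) := by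
  classical
  let pt : Fin m × Bool → X := fun q => bif q.2 then (f q.1).2 else (f q.1).1
  let tr : ι → Finset (Fin m × Bool) := fun b => univ.filter fun q => R b (pt q)
  -- The traces of the family on the 2m sampled positions. There are only polynomially many, which
  -- makes a union bound over them affordable.
  let 𝒯 : Finset (Finset (Fin m × Bool)) := univ.filter fun T => ∃ b, tr b = T
  have h𝒯 : #𝒯 ≤ d * (2 * m + 1) ^ d := by
    have := card_le_of_not_shatters 𝒯 d (fun S hS => by
      by_contra hd
      push Not at hd
      obtain ⟨S', hS'S, hS'⟩ := exists_subset_card_eq hd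
      have hsh := hS.mono_right hS'S
      apply hR
      let e := S'.equivFinOfCardEq hS'
      refine ⟨fun i => pt (e.symm i).1, fun I => ?_⟩
      obtain ⟨T, hT, hTS⟩ := hsh (t := S'.filter fun q => ∃ i ∈ I, (e.symm i).1 = q)
        (filter_subset _ _)
      obtain ⟨b, rfl⟩ := (mem_filter.1 hT).2
      refine ⟨b, fun i => ?_⟩
      have := congrArg (fun U => (e.symm i).1 ∈ U) hTS
      simp only [mem_inter, mem_filter, tr, mem_univ, true_and, eq_iff_iff,
        (e.symm i).2] at this
      rw [this]
      constructor
      · rintro ⟨i', hi', h'⟩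
        have : i' = i := e.symm.injective (Subtype.ext h')
        exact this ▸ hi'
      · exact fun hi => ⟨i, hi, rfl⟩)
    simpa [Fintype.card_prod, mul_comm] using this
  let Bad : Finset (Fin m → Bool) := univ.filter fun σ => c ≤ h (swapPairs σ f)
  have hBad : #Bad * 2 ^ c ≤ #𝒯 * 2 ^ m := by
    -- The set selected by `B` depends on σ, but its trace T is one of the members of `𝒯`. It avoids
    -- the first half after swapping and meets the second half at least c times.
    have hsub : Bad ⊆ 𝒯.biUnion fun T =>
        {σ : Fin m → Bool | (∀ i, (i, σ i) ∉ T) ∧ c ≤ #{i | (i, !σ i) ∈ T}} := by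
      intro σ hσ
      have hσ' : c ≤ h (swapPairs σ f) := (mem_filter.1 hσ).2
      set b := B fun i => (swapPairs σ f i).1 with hb
      have e1 : ∀ i, (swapPairs σ f i).1 = pt (i, σ i) := by
        intro i; simp only [swapPairs, Equiv.coe_fn_mk, pt]; cases σ i <;> simp
      have e2 : ∀ i, (swapPairs σ f i).2 = pt (i, !σ i) := by
        intro i; simp only [swapPairs, Equiv.coe_fn_mk, pt]; cases σ i <;> simp
      rw [mem_biUnion]
      refine ⟨tr b, by simp [𝒯], ?_⟩
      simp only [mem_filter, mem_univ, true_and, tr]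
      refine ⟨fun i => ?_, ?_⟩
      · rw [← e1]; exact hB _ i
      · rw [hh, Nat.card_eq_fintype_card, Fintype.card_subtype] at hσ'
        convert hσ' using 4
        rw [e2]
    calc #Bad * 2 ^ c ≤ (∑ T ∈ 𝒯, #{σ : Fin m → Bool |
          (∀ i, (i, σ i) ∉ T) ∧ c ≤ #{i | (i, !σ i) ∈ T}}) * 2 ^ c :=
          Nat.mul_le_mul_right _ ((card_le_card hsub).trans card_biUnion_le)
      _ ≤ ∑ _T ∈ 𝒯, 2 ^ m := by
          rw [sum_mul]; exact sum_le_sum fun T _ => card_avoiding_le T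
      _ = _ := by simp
  have hBadR : (#Bad : ℝ) ≤ 2 ^ m * (d * (2 * m + 1) ^ d / 2 ^ c) := by
    have h1 : (#Bad : ℝ) * 2 ^ c ≤ d * (2 * m + 1) ^ d * 2 ^ m := by
      have : #Bad * 2 ^ c ≤ d * (2 * m + 1) ^ d * 2 ^ m :=
        hBad.trans (Nat.mul_le_mul_right _ h𝒯)
      exact_mod_cast this
    rw [mul_div_assoc', le_div_iff₀ (by positivity)]
    linarith
  have hle : ∀ σ : Fin m → Bool, (h (swapPairs σ f) : ℝ) ≤ c + if σ ∈ Bad then (m : ℝ) else 0 := by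
    intro σ
    split_ifs with hσ
    · have : h (swapPairs σ f) ≤ m := by
        rw [hh, Nat.card_eq_fintype_card]
        simpa using Fintype.card_subtype_le
          (fun i => R (B fun i => (swapPairs σ f i).1) (swapPairs σ f i).2)
      have : (h (swapPairs σ f) : ℝ) ≤ m := by exact_mod_cast this
      linarith [(Nat.cast_nonneg c : (0 : ℝ) ≤ c)]
    · have : h (swapPairs σ f) ≤ c := by
        simp only [Bad, mem_filter, mem_univ, true_and, not_le] at hσ
        exact hσ.le
      simpa using this
  calc (∑ σ : Fin m → Bool, (h (swapPairs σ f) : ℝ))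
      ≤ ∑ σ : Fin m → Bool, ((c : ℝ) + if σ ∈ Bad then (m : ℝ) else 0) :=
        sum_le_sum fun σ _ => hle σ
    _ = 2 ^ m * c + #Bad * m := by simp [sum_add_distrib]
    _ ≤ 2 ^ m * c + 2 ^ m * (d * (2 * m + 1) ^ d / 2 ^ c) * m := by gcongr
    _ = _ := by ring

/-- The `ε`-net theorem for families of bounded VC-dimension. -/
theorem exists_net (d : ℕ) {ε : ℝ} (hε : 0 < ε) :
    ∃ m : ℕ, ∀ {X ι : Type u} [Fintype X] (R : ι → X → Prop) (_ : ¬ ShattersTuple R d)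
      (w : X → ℝ) (_ : w ∈ stdSimplex ℝ X),
      ∃ s : Fin m → X, ∀ b, ε ≤ ∑ x, w x * Set.indicator {x | R b x} 1 x → ∃ i, R b (s i) := by
  classical
  obtain ⟨m, c, hmc⟩ := exists_sample_sizes d hε
  refine ⟨m, fun {X ι} _ R hR w hw => ?_⟩
  -- If there is no net of size m, each sample `s` misses a set `B s` of weight at least ε. The
  -- expected number of hits of `B s` by a second, independent sample is estimated in two ways.
  by_contra! hcon
  choose B hBw hB using hcon
  let h : (Fin m → X × X) → ℕ := fun f => Nat.card {i // R (B fun i => (f i).1) (f i).2}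
  let W : (Fin m → X × X) → ℝ := fun f => ∏ i, (w (f i).1 * w (f i).2)
  have hW0 : ∀ f, 0 ≤ W f := fun f => prod_nonneg fun i _ => mul_nonneg (hw.1 _) (hw.1 _)
  have hsplit : ∀ G : (Fin m → X) → (Fin m → X) → ℝ,
      ∑ f : Fin m → X × X, W f * G (fun i => (f i).1) (fun i => (f i).2) =
        ∑ s : Fin m → X, (∏ i, w (s i)) * ∑ s' : Fin m → X, (∏ i, w (s' i)) * G s s' := by
    intro G
    rw [← (Equiv.arrowProdEquivProdArrow (Fin m) (fun _ => X) (fun _ => X)).symm.sum_comp,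
      Fintype.sum_prod_type]
    refine sum_congr rfl fun s _ => ?_
    rw [mul_sum]
    refine sum_congr rfl fun s' _ => ?_
    simp only [W, Equiv.arrowProdEquivProdArrow, Equiv.coe_fn_symm_mk, prod_mul_distrib]
    ring
  have hWsum : ∑ f, W f = 1 := by
    have := hsplit fun _ _ => 1
    simpa [sum_prod_eq_one w hw.2] using this
  -- With the first half fixed, each coordinate of the second half hits `B s` with probability at
  -- least ε.
  have hlow : m * ε ≤ ∑ f, W f * h f := by
    have hexp : ∀ f, (h f : ℝ) = ∑ j, Set.indicator {x | R (B fun i => (f i).1) x}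
        (1 : X → ℝ) (f j).2 := by
      intro f
      simp only [h, Nat.card_eq_fintype_card, Fintype.card_subtype, Set.indicator_apply,
        Set.mem_ofPred_eq, Pi.one_apply, sum_boole]
    simp_rw [hexp]
    rw [hsplit fun s s' => ∑ j, Set.indicator {x | R (B s) x} (1 : X → ℝ) (s' j)]
    have : ∀ s : Fin m → X, m * ε ≤ ∑ s' : Fin m → X, (∏ i, w (s' i)) *
        ∑ j, Set.indicator {x | R (B s) x} (1 : X → ℝ) (s' j) := by
      intro s
      simp_rw [mul_sum]
      rw [sum_comm]
      simp_rw [sum_prod_mul_apply w hw.2]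
      simpa using mul_le_mul_of_nonneg_left (hBw s) (Nat.cast_nonneg m)
    calc (m * ε : ℝ) = ∑ s : Fin m → X, (∏ i, w (s i)) * (m * ε) := by
          rw [← sum_mul, sum_prod_eq_one w hw.2, one_mul]
      _ ≤ _ := sum_le_sum fun s _ =>
          mul_le_mul_of_nonneg_left (this s) (prod_nonneg fun i _ => hw.1 _)
  have hWswap : ∀ (σ : Fin m → Bool) f, W (swapPairs σ f) = W f := by
    intro σ f
    refine prod_congr rfl fun i _ => ?_
    simp only [swapPairs, Equiv.coe_fn_mk]
    cases σ i <;> simp [mul_comm]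
  -- The product weight is invariant under swaps, so the expectation may be averaged over all swaps
  -- before the pairs are drawn.
  have hsym : (2 ^ m : ℝ) * ∑ f, W f * h f =
      ∑ f, W f * ∑ σ : Fin m → Bool, (h (swapPairs σ f) : ℝ) := by
    simp_rw [mul_sum]
    rw [sum_comm]
    have : ∀ σ : Fin m → Bool, ∑ f, W f * (h (swapPairs σ f) : ℝ) = ∑ f, W f * h f := by
      intro σ
      rw [← (swapPairs σ).sum_comp (fun f => W f * (h f : ℝ))]
      exact sum_congr rfl fun f _ => by rw [hWswap]
    simp_rw [this]
    simp [mul_sum]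
  have hup : (2 ^ m : ℝ) * ∑ f, W f * h f ≤
      2 ^ m * (c + m * (d * (2 * m + 1) ^ d / 2 ^ c)) := by
    rw [hsym]
    calc _ ≤ ∑ f, W f * (2 ^ m * (c + m * (d * (2 * m + 1) ^ d / 2 ^ c))) :=
          sum_le_sum fun f _ => mul_le_mul_of_nonneg_left
            (sum_swap_le R hR B hB f h fun _ => rfl) (hW0 f)
      _ = _ := by rw [← sum_mul, hWsum, one_mul]
  have := le_of_mul_le_mul_left hup (by positivity)
  linarith

/-! ### Minimax and bounded separation -/

/-- A form of von Neumann's minimax theorem. -/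
theorem exists_mixed_strategy {X Y : Type*} [Fintype X] [Fintype Y] [Nonempty X]
    (A : X → Y → ℝ) (c : ℝ)
    (h : ∀ μ ∈ stdSimplex ℝ X, ∃ y, c < ∑ x, μ x * A x y) :
    ∃ ν ∈ stdSimplex ℝ Y, ∀ x, c < ∑ y, ν y * A x y := by
  classical
  let f : (X → ℝ) → (Y → ℝ) → ℝ := fun μ ν => ∑ x, ∑ y, μ x * (ν y * A x y)
  have hadd₁ : ∀ (a b : ℝ) μ μ' ν, f (a • μ + b • μ') ν = a * f μ ν + b * f μ' ν := by
    intro a b μ μ' ν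
    simp only [f, mul_sum, ← sum_add_distrib, Pi.add_apply, Pi.smul_apply, smul_eq_mul]
    exact sum_congr rfl fun _ _ => sum_congr rfl fun _ _ => by ring
  have hadd₂ : ∀ (a b : ℝ) μ ν ν', f μ (a • ν + b • ν') = a * f μ ν + b * f μ ν' := by
    intro a b μ ν ν'
    simp only [f, mul_sum, ← sum_add_distrib, Pi.add_apply, Pi.smul_apply, smul_eq_mul]
    exact sum_congr rfl fun _ _ => sum_congr rfl fun _ _ => by ring
  have hX := convex_stdSimplex ℝ X
  have hY := convex_stdSimplex ℝ Y
  -- Sion's theorem for the bilinear payoff. The finite set of test strategies consists of the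
  -- vertices of the simplex over `Y`, since the hypothesis supplies a pure reply to each μ.
  obtain ⟨ν, hν, h'⟩ := Sion.exists_lt_iInf_of_lt_iInf_of_finite (X := stdSimplex ℝ X)
    (Y := stdSimplex ℝ Y) (f := f) (t := c) (s := Set.range fun y => Pi.single y 1)
    ⟨_, single_mem_stdSimplex ℝ (Classical.arbitrary X)⟩ (isCompact_stdSimplex ℝ X)
    (fun ν _ => (Continuous.lowerSemicontinuous (by fun_prop)).lowerSemicontinuousOn _)
    (fun ν _ => ConvexOn.quasiconvexOn ⟨hX, fun μ _ μ' _ a b _ _ _ => (hadd₁ a b μ μ' ν).le⟩)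
    hY
    (fun μ _ => (Continuous.upperSemicontinuous (by fun_prop)).upperSemicontinuousOn _)
    (fun μ _ => ConcaveOn.quasiconcaveOn ⟨hY, fun ν _ ν' _ a b _ _ _ => (hadd₂ a b μ ν ν').ge⟩)
    hX (Set.finite_range _)
    (by rintro _ ⟨y, rfl⟩; exact single_mem_stdSimplex ℝ y)
    (fun μ hμ => by
      obtain ⟨y, hy⟩ := h μ hμ
      exact ⟨_, ⟨y, rfl⟩, by simpa [f, Pi.single_apply] using hy⟩)
  refine ⟨ν, hν, fun x => ?_⟩
  simpa [f, Pi.single_apply] using h' _ (single_mem_stdSimplex ℝ x)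

theorem ShattersTuple.comp {X X' ι : Type*} {R : ι → X → Prop} {d : ℕ} (g : X' → X)
    (h : ShattersTuple (fun b x => R b (g x)) d) : ShattersTuple R d := by
  obtain ⟨a, ha⟩ := h
  exact ⟨fun i => g (a i), ha⟩

/-- If `r` is a relation of bounded VC-dimension and each `m` points of `Y`, for a suitable `m`, are
separated into `Z` and its complement by some `r x`, then the separation of each finite set can be
done with a bounded number of points `x`. -/
theorem exists_separation_bound {X Y : Type u} [Nonempty X] (r : X → Y → Prop) (d₁ d₂ : ℕ)
    (h₁ : ¬ ShattersTuple r d₁)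
    (h₂ : ¬ ShattersTuple (fun (q : Y × Y) x => r x q.1 ∧ ¬ r x q.2) d₂) :
    ∃ m n : ℕ, ∀ Z : Set Y,
      (∀ s : Fin m → Y, ∃ x, ∀ i, r x (s i) ↔ s i ∈ Z) →
      ∀ F : Finset Y, ∃ x : Fin n → X, ∀ t ∈ F, ∀ t' ∈ F, t ∈ Z → t' ∉ Z →
        ∃ i, r (x i) t ∧ ¬ r (x i) t' := by
  classical
  obtain ⟨m, hm⟩ := exists_net.{u} d₁ (ε := 1 / 3) (by norm_num)
  obtain ⟨n, hn⟩ := exists_net.{u} d₂ (ε := 1 / 3) (by norm_num)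
  refine ⟨m, n, fun Z hZ F => ?_⟩
  rcases F.eq_empty_or_nonempty with rfl | hF
  · exact ⟨fun _ => Classical.arbitrary X, by simp⟩
  have : Nonempty F := hF.to_subtype
  -- The minimax theorem needs finitely many strategies, so points of `X` are identified when they
  -- have the same trace on `F`.
  let V := {S : Set F // ∃ x, S = {t : F | r x t}}
  have : Fintype V := Fintype.ofFinite V
  choose rep hrep using fun v : V => v.2
  have hrep' : ∀ (v : V) (t : F), t ∈ v.1 ↔ r (rep v) t := fun v t => by
    conv_lhs => rw [hrep v]
    rfl
  let A : F → V → ℝ := fun t v => if (r (rep v) t ↔ t.1 ∈ Z) then 1 else 0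
  -- Taking symmetric differences with the fixed set `Z` only flips the pattern to be realized and
  -- preserves shattering.
  have hflip : ¬ ShattersTuple (fun (x : X) (t : F) => ¬ (r x t ↔ t.1 ∈ Z)) d₁ := by
    rintro ⟨a, ha⟩
    refine h₁ ⟨fun i => (a i).1, fun I => ?_⟩
    obtain ⟨x, hx⟩ := ha {i | ¬ (i ∈ I ↔ (a i).1 ∈ Z)}
    refine ⟨x, fun i => ?_⟩
    have := hx i
    rw [Set.mem_ofPred_eq] at this
    tauto
  obtain ⟨ν, hν, hνA⟩ := exists_mixed_strategy A (2 / 3) fun μ hμ => by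
    obtain ⟨s, hs⟩ := hm _ hflip μ hμ
    obtain ⟨x, hx⟩ := hZ fun i => (s i).1
    -- `x` makes no error on the net, so its error set has weight less than 1/3.
    have hlt := mt (hs x) (by
      push Not
      exact hx)
    let v : V := ⟨{t : F | r x t}, x, rfl⟩
    refine ⟨v, ?_⟩
    have hv : ∀ t : F, r (rep v) t ↔ r x t := fun t => (hrep' v t).symm
    have hsum : ∑ t, μ t * A t v +
        ∑ t, μ t * Set.indicator {t : F | ¬ (r x t ↔ t.1 ∈ Z)} 1 t = 1 := by
      rw [← sum_add_distrib, ← hμ.2]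
      refine sum_congr rfl fun t _ => ?_
      simp only [A, hv, Set.indicator_apply, Set.mem_ofPred_eq, Pi.one_apply]
      split_ifs <;> simp
    linarith
  obtain ⟨s, hs⟩ := hn (fun (q : Y × Y) (v : V) => r (rep v) q.1 ∧ ¬ r (rep v) q.2)
    (fun h => h₂ (h.comp rep (R := fun (q : Y × Y) x => r x q.1 ∧ ¬ r x q.2))) ν hν
  refine ⟨fun i => rep (s i), fun t ht t' ht' htZ htZ' => hs (t, t') ?_⟩
  have h1 := hνA ⟨t, ht⟩
  have h2 := hνA ⟨t', ht'⟩
  -- A trace that is right about both t ∈ Z and t' ∉ Z separates them. Each of the two is right with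
  -- probability above 2/3, hence both with probability above 1/3, and the second net catches such a
  -- trace.
  have h3 : ∑ v, ν v * A ⟨t, ht⟩ v + ∑ v, ν v * A ⟨t', ht'⟩ v ≤
      ∑ v, ν v * Set.indicator {v : V | r (rep v) t ∧ ¬ r (rep v) t'} 1 v + ∑ v, ν v := by
    rw [← sum_add_distrib, ← sum_add_distrib]
    refine sum_le_sum fun v _ => ?_
    have hv := hν.1 v
    simp only [A, htZ, htZ', iff_true, iff_false, Set.indicator_apply, Set.mem_ofPred_eq,
      Pi.one_apply]
    by_cases c1 : r (rep v) t <;> by_cases c2 : r (rep v) t' <;> simp [c1, c2, hv]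
  rw [hν.2] at h3
  linarith

end NIPCombinatorics

namespace ManySorted

open ManySorted.Language

/-! ### Substitution of terms into formulas -/

section Substitution

variable {L : Language.{u}} {α β : Type}

theorem Tuple.append_eta {M : Structure L} {v : α → L.Sorts} {w : β → L.Sorts}
    (z : Tuple M (Sum.elim v w)) :
    Tuple.append (fun a => z (.inl a)) (fun b => z (.inr b)) = z := by
  funext i
  cases i <;> rfl

namespace Language

/-- Simultaneous substitution of terms for the variables of a term. -/
def Term.subst {v : α → L.Sorts} {w : β → L.Sorts} (f : ∀ a, L.Term w (v a)) :
    {s : L.Sorts} → L.Term v s → L.Term w s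
  | _, .var a => f a
  | _, .app F ts => .app F fun i => (ts i).subst f

theorem Term.eval_subst {v : α → L.Sorts} {w : β → L.Sorts} (f : ∀ a, L.Term w (v a))
    (M : Structure L) (x : Tuple M w) {s : L.Sorts} (t : L.Term v s) :
    (t.subst f).eval M x = t.eval M fun a => (f a).eval M x := by
  induction t with
  | var a => rfl
  | app F ts ih => simp only [Term.subst, Term.eval, ih]

/-- Weakening of a term by a bound variable. -/
def Term.lift {w : β → L.Sorts} {Δ : List L.Sorts} (s₀ : L.Sorts) {s : L.Sorts}
    (t : L.Term (Sum.elim w Δ.get) s) : L.Term (Sum.elim w (s₀ :: Δ).get) s :=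
  t.subst fun
    | .inl b => .var (v := Sum.elim w (s₀ :: Δ).get) (.inl b)
    | .inr j => .var (v := Sum.elim w (s₀ :: Δ).get) (.inr j.succ)

theorem Term.eval_lift {w : β → L.Sorts} {Δ : List L.Sorts} {s₀ s : L.Sorts}
    (t : L.Term (Sum.elim w Δ.get) s) (M : Structure L) (x : Tuple M w) (b : Tuple M Δ.get)
    (a : M.carrier s₀) :
    (t.lift s₀).eval M (x.append (b.cons a)) = t.eval M (x.append b) := by
  rw [Term.lift, Term.eval_subst]
  congr 1
  funext i
  cases i <;> rfl

/-- Both the free variables and the context of bound variables may change, so that the induction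
passes a quantifier: there the old terms are weakened and the new variable is sent to itself. Only
the semantics of the result is recorded. -/
theorem BoundedFormula.exists_subst {v : α → L.Sorts} {w : β → L.Sorts} {Γ : List L.Sorts}
    (φ : L.BoundedFormula v Γ) : ∀ {Δ : List L.Sorts}
    (f : (i : α ⊕ Fin Γ.length) → L.Term (Sum.elim w Δ.get) (Sum.elim v Γ.get i)),
    ∃ ψ : L.BoundedFormula w Δ, ∀ (M : Structure L) (x : Tuple M w) (b : Tuple M Δ.get),
      ψ.Realize M x b ↔ φ.Realize M (fun i => (f (.inl i)).eval M (x.append b))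
        (fun j => (f (.inr j)).eval M (x.append b)) := by
  induction φ with
  | falsum => exact fun f => ⟨.falsum, fun M x b => Iff.rfl⟩
  | equal t₁ t₂ =>
    refine fun f => ⟨.equal (t₁.subst f) (t₂.subst f), fun M x b => ?_⟩
    have h := Tuple.append_eta (M := M) fun i => (f i).eval M (x.append b)
    exact Eq.congr ((Term.eval_subst f M _ t₁).trans (congrArg (fun z => t₁.eval M z) h.symm))
      ((Term.eval_subst f M _ t₂).trans (congrArg (fun z => t₂.eval M z) h.symm))
  | rel R ts =>
    refine fun f => ⟨.rel R fun i => (ts i).subst f, fun M x b => ?_⟩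
    have h := Tuple.append_eta (M := M) fun i => (f i).eval M (x.append b)
    exact iff_of_eq (congrArg (M.relMap R) (funext fun i =>
      (Term.eval_subst f M _ (ts i)).trans (congrArg (fun z => (ts i).eval M z) h.symm)))
  | imp φ ψ ihφ ihψ =>
    intro Δ f
    obtain ⟨φ', hφ⟩ := ihφ f
    obtain ⟨ψ', hψ⟩ := ihψ f
    exact ⟨.imp φ' ψ', fun M x b => by simp only [BoundedFormula.Realize, hφ, hψ]⟩
  | @all Γ s φ ih =>
    intro Δ f
    obtain ⟨φ', hφ⟩ := ih (Δ := s :: Δ) fun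
      | .inl a => (f (.inl a)).lift s
      | .inr j => Fin.cases (motive := fun j =>
          L.Term (Sum.elim w (s :: Δ).get) (Sum.elim v (s :: Γ).get (.inr j)))
          (.var (v := Sum.elim w (s :: Δ).get) (.inr 0)) (fun j => (f (.inr j)).lift s) j
    refine ⟨.all s φ', fun M x b => ?_⟩
    refine forall_congr' fun a => (hφ M x (b.cons a)).trans ?_
    refine iff_of_eq (congrArg₂ (φ.Realize M) (funext fun i => ?_) (funext fun j => ?_))
    · exact Term.eval_lift _ _ _ _ _
    · refine Fin.cases ?_ (fun j => ?_) j
      · rfl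
      · exact Term.eval_lift _ _ _ _ _

end Language

/-- Transport of a variable along an equality of sorts. -/
def Language.Term.castVar {w : β → L.Sorts} (b : β) {s : L.Sorts} (h : w b = s) : L.Term w s :=
  h ▸ .var b

end Substitution

/-! ### Closure properties of uniform definability -/

/-- The property `P` of tuples is defined by one formula in all structures of the family `𝓜`. -/
def UnifDef {L : Language.{u}} {ι : Type*} (𝓜 : ι → Structure L) {α : Type} (v : α → L.Sorts)
    (P : ∀ i, Tuple (𝓜 i) v → Prop) : Prop :=
  ∃ φ : L.Formula v, ∀ i x, φ.Holds (𝓜 i) x ↔ P i x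

namespace UnifDef

variable {L : Language.{u}} {ι : Type*} {𝓜 : ι → Structure L} {α β : Type} {v : α → L.Sorts}
  {w : β → L.Sorts}

theorem congr {P Q : ∀ i, Tuple (𝓜 i) v → Prop} (h : UnifDef 𝓜 v P) (hPQ : ∀ i x, P i x ↔ Q i x) :
    UnifDef 𝓜 v Q := by
  obtain ⟨φ, hφ⟩ := h
  exact ⟨φ, fun i x => (hφ i x).trans (hPQ i x)⟩

theorem formula (φ : L.Formula v) : UnifDef 𝓜 v fun i x => φ.Holds (𝓜 i) x :=
  ⟨φ, fun _ _ => Iff.rfl⟩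

theorem false : UnifDef 𝓜 v fun _ _ => False := ⟨.falsum, fun _ _ => Iff.rfl⟩

theorem imp {P Q : ∀ i, Tuple (𝓜 i) v → Prop} (hP : UnifDef 𝓜 v P) (hQ : UnifDef 𝓜 v Q) :
    UnifDef 𝓜 v fun i x => P i x → Q i x := by
  obtain ⟨φ, hφ⟩ := hP
  obtain ⟨ψ, hψ⟩ := hQ
  exact ⟨.imp φ ψ, fun i x => imp_congr (hφ i x) (hψ i x)⟩

theorem not {P : ∀ i, Tuple (𝓜 i) v → Prop} (hP : UnifDef 𝓜 v P) :
    UnifDef 𝓜 v fun i x => ¬ P i x :=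
  hP.imp false

theorem and {P Q : ∀ i, Tuple (𝓜 i) v → Prop} (hP : UnifDef 𝓜 v P) (hQ : UnifDef 𝓜 v Q) :
    UnifDef 𝓜 v fun i x => P i x ∧ Q i x :=
  (hP.imp hQ.not).not.congr fun _ _ => by tauto

theorem iff {P Q : ∀ i, Tuple (𝓜 i) v → Prop} (hP : UnifDef 𝓜 v P) (hQ : UnifDef 𝓜 v Q) :
    UnifDef 𝓜 v fun i x => (P i x ↔ Q i x) :=
  ((hP.imp hQ).and (hQ.imp hP)).congr fun _ _ => by tauto

theorem subst {P : ∀ i, Tuple (𝓜 i) v → Prop} (hP : UnifDef 𝓜 v P) (f : ∀ a, L.Term w (v a)) :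
    UnifDef 𝓜 w fun i x => P i fun a => (f a).eval (𝓜 i) x := by
  obtain ⟨φ, hφ⟩ := hP
  obtain ⟨ψ, hψ⟩ := BoundedFormula.exists_subst φ (w := w) (Δ := []) fun
    | .inl a => (f a).subst fun b => .var (v := Sum.elim w ([] : List L.Sorts).get) (.inl b)
    | .inr j => j.elim0
  refine ⟨ψ, fun i x => (hψ _ _ _).trans (Iff.trans ?_ (hφ i _))⟩
  refine iff_of_eq (congrArg₂ (BoundedFormula.Realize (𝓜 i) φ) (funext fun a => ?_)
    (funext fun j => j.elim0))
  exact Term.eval_subst _ _ _ (f a)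

theorem eq {s : L.Sorts} (t₁ t₂ : L.Term v s) :
    UnifDef 𝓜 v fun i x => t₁.eval (𝓜 i) x = t₂.eval (𝓜 i) x := by
  refine ⟨.equal (t₁.subst fun b => .var (v := Sum.elim v ([] : List L.Sorts).get) (.inl b))
    (t₂.subst fun b => .var (v := Sum.elim v ([] : List L.Sorts).get) (.inl b)), fun i x => ?_⟩
  exact Eq.congr (Term.eval_subst _ _ _ t₁) (Term.eval_subst _ _ _ t₂)

theorem rel (R : L.Relations) (ts : ∀ i, L.Term v (L.relDom R i)) :
    UnifDef 𝓜 v fun i x => (𝓜 i).relMap R fun j => (ts j).eval (𝓜 i) x := by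
  refine ⟨.rel R fun j =>
    (ts j).subst fun b => .var (v := Sum.elim v ([] : List L.Sorts).get) (.inl b), fun i x => ?_⟩
  exact iff_of_eq (congrArg ((𝓜 i).relMap R) (funext fun j => Term.eval_subst _ _ _ (ts j)))

theorem all_sort {s : L.Sorts} {P : ∀ i, Tuple (𝓜 i) v → (𝓜 i).carrier s → Prop}
    (h : UnifDef 𝓜 (Sum.elim v fun _ : Unit => s) fun i z =>
      P i (fun a => z (.inl a)) (z (.inr ()))) :
    UnifDef 𝓜 v fun i x => ∀ y, P i x y := by
  obtain ⟨φ, hφ⟩ := h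
  obtain ⟨ψ, hψ⟩ := BoundedFormula.exists_subst φ (w := v) (Δ := [s]) fun
    | .inl (.inl a) => .var (v := Sum.elim v [s].get) (.inl a)
    | .inl (.inr _) => .var (v := Sum.elim v [s].get) (.inr 0)
    | .inr j => j.elim0
  refine ⟨.all s ψ, fun i x => forall_congr' fun y => ?_⟩
  refine (hψ _ _ _).trans (Iff.trans ?_ (hφ i (x.append (w := fun _ : Unit => s) fun _ => y)))
  refine iff_of_eq (congrArg₂ (BoundedFormula.Realize (𝓜 i) φ) (funext fun a => ?_)
    (funext fun j => j.elim0))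
  rcases a with a | a <;> rfl

/-- Induction on the finite index type, one variable at a time through `Option`. Reindexing along an
equivalence matches sorts only up to a propositional equality, hence `Term.castVar`. -/
theorem all [Finite β] {P : ∀ i, Tuple (𝓜 i) v → Tuple (𝓜 i) w → Prop}
    (h : UnifDef 𝓜 (Sum.elim v w) fun i z => P i (fun a => z (.inl a)) (fun b => z (.inr b))) :
    UnifDef 𝓜 v fun i x => ∀ y, P i x y := by
  revert α
  induction β using Finite.induction_empty_option with
  | @of_equiv β γ e ih =>
    intro α v P h
    have hc : ∀ c, w (e (e.symm c)) = w c := fun c => by rw [e.apply_symm_apply]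
    refine (ih (w := fun b => w (e b)) (v := v)
      (P := fun i x y => P i x fun c => (Term.castVar (w := fun b => w (e b)) (e.symm c)
        (hc c)).eval (𝓜 i) y) ?_).congr fun i x => ⟨fun H y => ?_, fun H y => H _⟩
    · have := h.subst (w := Sum.elim v fun b => w (e b)) fun
        | .inl a => .var (v := Sum.elim v fun b => w (e b)) (.inl a)
        | .inr c => (Term.castVar (w := fun b => w (e b)) (e.symm c) (hc c)).subst
          fun b => .var (v := Sum.elim v fun b => w (e b)) (.inr b)
      refine this.congr fun i x => iff_of_eq (congrArg _ (funext fun c => ?_))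
      exact Term.eval_subst _ _ _ _
    · convert H fun b => y (e b) using 1
      funext c
      have : ∀ (b : β) (c : γ) (hb : e b = c) (h : w (e b) = w c),
          (Term.castVar (w := fun b => w (e b)) b h).eval (𝓜 i) (fun b => y (e b)) = y c := by
        intro b c hb h
        subst hb
        rfl
      exact (this _ _ (e.apply_symm_apply c) _).symm
  | h_empty =>
    intro α v P h
    refine (h.subst (w := v) fun
        | .inl a => .var a
        | .inr b => b.elim).congr fun i x => ⟨fun H y => ?_, fun H => H _⟩
    exact (iff_of_eq (congrArg (P i x) (funext fun b => b.elim))).mp H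
  | @h_option β _ ih =>
    intro α v P h
    have h1 := h.subst (w := Sum.elim (Sum.elim v fun _ : Unit => w none) fun b => w (some b)) fun
      | .inl a => .var
          (v := Sum.elim (Sum.elim v fun _ : Unit => w none) fun b => w (some b)) (.inl (.inl a))
      | .inr none => .var
          (v := Sum.elim (Sum.elim v fun _ : Unit => w none) fun b => w (some b)) (.inl (.inr ()))
      | .inr (some b) => .var
          (v := Sum.elim (Sum.elim v fun _ : Unit => w none) fun b => w (some b)) (.inr b)
    have h2 := ih (P := fun i x y => P i (fun a => x (.inl a)) fun
      | none => x (.inr ())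
      | some b => y b) (h1.congr fun i x => iff_of_eq (congrArg _ (by
        funext b
        cases b <;> rfl)))
    refine (all_sort (P := fun i x a => ∀ y : Tuple (𝓜 i) fun b => w (some b), P i x fun
      | none => a
      | some b => y b) h2).congr fun i x => ⟨fun H y => ?_, fun H a y => H _⟩
    convert H (y none) fun b => y (some b) using 1
    funext b
    cases b <;> rfl

theorem exists' [Finite β] {P : ∀ i, Tuple (𝓜 i) v → Tuple (𝓜 i) w → Prop}
    (h : UnifDef 𝓜 (Sum.elim v w) fun i z => P i (fun a => z (.inl a)) (fun b => z (.inr b))) :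
    UnifDef 𝓜 v fun i x => ∃ y, P i x y :=
  (all (P := fun i x y => ¬ P i x y) h.not).not.congr fun _ _ => not_forall_not

theorem forall_finite {J : Type*} [Finite J] {P : J → ∀ i, Tuple (𝓜 i) v → Prop}
    (h : ∀ j, UnifDef 𝓜 v (P j)) : UnifDef 𝓜 v fun i x => ∀ j, P j i x := by
  classical
  have := Fintype.ofFinite J
  have key : ∀ S : Finset J, UnifDef 𝓜 v fun i x => ∀ j ∈ S, P j i x := by
    intro S
    induction S using Finset.induction_on with
    | empty => exact (false.not).congr (by simp)
    | insert j S _ ih => exact ((h j).and ih).congr (by simp)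
  exact (key Finset.univ).congr (by simp)

theorem exists_finite {J : Type*} [Finite J] {P : J → ∀ i, Tuple (𝓜 i) v → Prop}
    (h : ∀ j, UnifDef 𝓜 v (P j)) : UnifDef 𝓜 v fun i x => ∃ j, P j i x :=
  (forall_finite fun j => (h j).not).not.congr fun _ _ => not_forall_not

/-- A finite tuple of parameters can be listed as a tuple indexed by some `Fin k`. -/
theorem exists_formula_fin [Finite β] {P : ∀ i, Tuple (𝓜 i) v → Tuple (𝓜 i) w → Prop}
    (h : UnifDef 𝓜 (Sum.elim v w) fun i z => P i (fun a => z (.inl a)) (fun b => z (.inr b))) :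
    ∃ (k : ℕ) (e : Fin k ≃ β) (ψ : L.Formula (Sum.elim v fun j => w (e j))),
      ∀ i x y, ψ.Holds₂ (𝓜 i) x (fun j => y (e j)) ↔ P i x y := by
  obtain ⟨k, ⟨e⟩⟩ := Finite.exists_equiv_fin β
  have hc : ∀ c, w (e.symm (e c)) = w c := fun c => by rw [e.symm_apply_apply]
  obtain ⟨ψ, hψ⟩ := h.subst (w := Sum.elim v fun j => w (e.symm j)) fun
    | .inl a => .var (v := Sum.elim v fun j => w (e.symm j)) (.inl a)
    | .inr c => (Term.castVar (w := fun j => w (e.symm j)) (e c) (hc c)).subst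
      fun b => .var (v := Sum.elim v fun j => w (e.symm j)) (.inr b)
  refine ⟨k, e.symm, ψ, fun i x y => (hψ i _).trans ?_⟩
  refine iff_of_eq (congrArg _ (funext fun c => (Term.eval_subst _ _ _ _).trans ?_))
  have : ∀ (b : Fin k) (c : β) (hb : e.symm b = c) (h : w (e.symm b) = w c),
      (Term.castVar (w := fun b => w (e.symm b)) b h).eval (𝓜 i) (fun b => y (e.symm b)) =
        y c := by
    intro b c hb h
    subst hb
    rfl
  exact this _ _ (e.symm_apply_apply c) _

end UnifDef

/-! ### Interpretations: reducts and imaginaries -/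

/-- An interpretation, uniform in `i`, of the structures `𝓜 i` in the structures `𝓝 i`: the elements
of a sort `s` are represented by tuples, and the function symbols by tuples of terms. -/
structure Interpretation {L₁ L₂ : Language.{u}} {ι : Type*} (𝓜 : ι → Structure L₁)
    (𝓝 : ι → Structure L₂) where
  arity : L₁.Sorts → ℕ
  dom : (s : L₁.Sorts) → Fin (arity s) → L₂.Sorts
  proj : (i : ι) → (s : L₁.Sorts) → Tuple (𝓝 i) (dom s) → (𝓜 i).carrier s
  surj : ∀ i s, Function.Surjective (proj i s)
  eq_def : ∀ s, UnifDef 𝓝 (Sum.elim (dom s) (dom s)) fun i z =>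
    proj i s (fun j => z (.inl j)) = proj i s fun j => z (.inr j)
  rel_def : ∀ R, UnifDef 𝓝
    (fun q : Σ a : Fin (L₁.relArity R), Fin (arity (L₁.relDom R a)) => dom (L₁.relDom R q.1) q.2)
    fun i z => (𝓜 i).relMap R fun a => proj i _ fun j => z ⟨a, j⟩
  fun_def : ∀ f, ∃ G : ∀ j, L₂.Term
    (fun q : Σ a : Fin (L₁.funArity f), Fin (arity (L₁.funDom f a)) => dom (L₁.funDom f q.1) q.2)
    (dom (L₁.funCod f) j), ∀ i z,
      (𝓜 i).funMap f (fun a => proj i _ fun j => z ⟨a, j⟩) =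
        proj i _ fun j => (G j).eval (𝓝 i) z

namespace Interpretation

variable {L₁ L₂ : Language.{u}} {ι : Type*} {𝓜 : ι → Structure L₁} {𝓝 : ι → Structure L₂}
  (I : Interpretation 𝓜 𝓝) {α : Type}

/-- The sorts of the variables representing variables of sorts `v`. -/
abbrev expand (v : α → L₁.Sorts) : (Σ a, Fin (I.arity (v a))) → L₂.Sorts :=
  fun q => I.dom (v q.1) q.2

/-- The tuple represented by a tuple. -/
abbrev projTuple (i : ι) {v : α → L₁.Sorts} (z : Tuple (𝓝 i) (I.expand v)) : Tuple (𝓜 i) v :=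
  fun a => I.proj i (v a) fun j => z ⟨a, j⟩

theorem exists_term {v : α → L₁.Sorts} {s : L₁.Sorts} (t : L₁.Term v s) :
    ∃ T : ∀ j, L₂.Term (I.expand v) (I.dom s j), ∀ i z,
      t.eval (𝓜 i) (I.projTuple i z) = I.proj i s fun j => (T j).eval (𝓝 i) z := by
  induction t with
  | var a => exact ⟨fun j => .var (v := I.expand v) ⟨a, j⟩, fun i z => rfl⟩
  | app f ts ih =>
    choose T hT using ih
    obtain ⟨G, hG⟩ := I.fun_def f
    refine ⟨fun j => (G j).subst fun q : Σ a : Fin (L₁.funArity f), Fin (I.arity (L₁.funDom f a)) => T q.1 q.2, fun i z => ?_⟩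
    simp only [Term.eval, hT, Term.eval_subst]
    exact hG i fun q => (T q.1 q.2).eval (𝓝 i) z

/-- A quantifier over a sort becomes a quantifier over representing tuples, which is correct because
`proj` is surjective. Atomic formulas are handled by `eq_def`, `rel_def` and the translation of
terms. -/
theorem unifDef_realize {v : α → L₁.Sorts} {Γ : List L₁.Sorts} (φ : L₁.BoundedFormula v Γ) :
    UnifDef 𝓝 (I.expand (Sum.elim v Γ.get)) fun i z =>
      φ.Realize (𝓜 i) (fun a => I.projTuple i z (.inl a)) (fun j => I.projTuple i z (.inr j)) := by
  induction φ with
  | falsum => exact UnifDef.false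
  | @equal Γ s t₁ t₂ =>
    obtain ⟨T₁, h₁⟩ := I.exists_term t₁
    obtain ⟨T₂, h₂⟩ := I.exists_term t₂
    refine ((I.eq_def s).subst fun
      | .inl j => T₁ j
      | .inr j => T₂ j).congr fun i z => ?_
    have h := Tuple.append_eta (M := 𝓜 i) (I.projTuple i z)
    exact Eq.congr ((h₁ i z).symm.trans (congrArg (fun y => t₁.eval (𝓜 i) y) h.symm))
      ((h₂ i z).symm.trans (congrArg (fun y => t₂.eval (𝓜 i) y) h.symm))
  | @rel Γ R ts =>
    choose T hT using fun a => I.exists_term (ts a)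
    refine ((I.rel_def R).subst fun q => T q.1 q.2).congr fun i z => ?_
    have h := Tuple.append_eta (M := 𝓜 i) (I.projTuple i z)
    exact iff_of_eq (congrArg ((𝓜 i).relMap R) (funext fun a =>
      (hT a i z).symm.trans (congrArg (fun y => (ts a).eval (𝓜 i) y) h.symm)))
  | imp φ ψ ihφ ihψ => exact ihφ.imp ihψ
  | @all Γ s φ ih =>
    have h := ih.subst (w := Sum.elim (I.expand (Sum.elim v Γ.get)) (I.dom s)) fun
      | ⟨.inl a, q⟩ => .var (v := Sum.elim (I.expand (Sum.elim v Γ.get)) (I.dom s))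
          (.inl ⟨.inl a, q⟩)
      | ⟨.inr j, q⟩ => Fin.cases (motive := fun j => ∀ q : Fin (I.arity ((s :: Γ).get j)),
          L₂.Term (Sum.elim (I.expand (Sum.elim v Γ.get)) (I.dom s)) (I.dom ((s :: Γ).get j) q))
          (fun q => .var (v := Sum.elim (I.expand (Sum.elim v Γ.get)) (I.dom s)) (.inr q))
          (fun j q => .var (v := Sum.elim (I.expand (Sum.elim v Γ.get)) (I.dom s))
            (.inl ⟨.inr j, q⟩)) j q
    refine (UnifDef.all (w := I.dom s) (P := fun i z y => φ.Realize (𝓜 i)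
      (fun a => I.projTuple i z (.inl a))
      (Tuple.cons (I.proj i s y) fun j => I.projTuple i z (.inr j))) (h.congr fun i z => ?_)).congr
        fun i z => ⟨fun H a => ?_, fun H y => H _⟩
    · refine iff_of_eq (congrArg₂ (φ.Realize (𝓜 i)) rfl (funext fun j => ?_))
      refine Fin.cases ?_ (fun j => ?_) j <;> rfl
    · obtain ⟨y, rfl⟩ := I.surj i s a
      exact H y

theorem unifDef_holds {v : α → L₁.Sorts} (φ : L₁.Formula v) :
    UnifDef 𝓝 (I.expand v) fun i z => φ.Holds (𝓜 i) (I.projTuple i z) := by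
  refine ((I.unifDef_realize φ).subst (w := I.expand v) fun
    | ⟨.inl a, q⟩ => .var (v := I.expand v) ⟨a, q⟩
    | ⟨.inr j, q⟩ => j.elim0).congr fun i z => ?_
  exact iff_of_eq (congrArg₂ (BoundedFormula.Realize (𝓜 i) φ) rfl (funext fun j => j.elim0))

end Interpretation

section Instances

variable {L : Language.{u}}

theorem UnifDef.eq_single {ι : Type*} {𝓜 : ι → Structure L} (s : L.Sorts) :
    UnifDef 𝓜 (Sum.elim (fun _ : Fin 1 => s) fun _ : Fin 1 => s) fun i z =>
      (z (.inl 0) : (𝓜 i).carrier s) = z (.inr 0) :=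
  UnifDef.eq (v := Sum.elim (fun _ : Fin 1 => s) fun _ : Fin 1 => s) (s := s)
    (Term.var (v := Sum.elim (fun _ : Fin 1 => s) fun _ : Fin 1 => s) (Sum.inl 0))
    (Term.var (v := Sum.elim (fun _ : Fin 1 => s) fun _ : Fin 1 => s) (Sum.inr 0))

/-- A structure interprets its reducts. -/
def reductInterpretation {ι : Type*} (𝓜 : ι → Structure L) (K : Sublanguage L) :
    Interpretation (fun i => (𝓜 i).reduct K) 𝓜 where
  arity _ := 1
  dom s _ := s.1
  proj _ _ z := z 0
  surj _ _ y := ⟨fun _ => y, rfl⟩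
  eq_def s := UnifDef.eq_single s.1
  rel_def R := UnifDef.rel
    (v := fun q : Σ _ : Fin (L.relArity R.1), Fin 1 => L.relDom R.1 q.1) R.1
    fun j => .var (v := fun q : Σ _ : Fin (L.relArity R.1), Fin 1 => L.relDom R.1 q.1) ⟨j, 0⟩
  fun_def f := ⟨fun _ => .app f.1 fun j =>
    .var (v := fun q : Σ _ : Fin (L.funArity f.1), Fin 1 => L.funDom f.1 q.1) ⟨j, 0⟩,
    fun _ _ => rfl⟩

/-- `N^eq` interprets `N`. -/
def toEqInterpretation (N : Structure L) :
    Interpretation (fun _ : Unit => N) (fun _ : Unit => N.eq) where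
  arity _ := 1
  dom s _ := .inl s
  proj _ _ z := z 0
  surj _ _ y := ⟨fun _ => y, rfl⟩
  eq_def s := UnifDef.eq_single (L := N.eqLanguage) (Sum.inl s)
  rel_def R := UnifDef.rel (L := N.eqLanguage) (𝓜 := fun _ => N.eq)
    (v := fun q : Σ _ : Fin (L.relArity R), Fin 1 => Sum.inl (L.relDom R q.1)) R
    fun j => Term.var (L := N.eqLanguage) (v := fun q : Σ _ : Fin (L.relArity R), Fin 1 =>
      (Sum.inl (L.relDom R q.1) : N.eqLanguage.Sorts)) ⟨j, 0⟩
  fun_def f := ⟨fun _ => Term.app (L := N.eqLanguage) (Sum.inl f) fun j =>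
    Term.var (L := N.eqLanguage) (v := fun q : Σ _ : Fin (L.funArity f), Fin 1 =>
      (Sum.inl (L.funDom f q.1) : N.eqLanguage.Sorts)) ⟨j, 0⟩,
    fun _ _ => rfl⟩

/-- `N` interprets `N^eq`. -/
def ofEqInterpretation (N : Structure L) :
    Interpretation (fun _ : Unit => N.eq) (fun _ : Unit => N) where
  arity
    | .inl _ => 1
    | .inr E => E.arity
  dom
    | .inl s => fun _ => s
    | .inr E => E.dom
  proj _
    | .inl _ => fun z => z 0
    | .inr E => fun z => Quotient.mk E.setoid z
  surj _
    | .inl _ => fun y => ⟨fun _ => y, rfl⟩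
    | .inr E => fun y => Quotient.exists_rep y
  eq_def
    | .inl s => UnifDef.eq_single s
    | .inr E => (UnifDef.formula E.rel).congr fun _ z => by
        refine Iff.trans ?_ (Quotient.eq (r := E.setoid)).symm
        exact iff_of_eq (congrArg _ (Tuple.append_eta z).symm)
  rel_def R := UnifDef.rel
    (v := fun q : Σ _ : Fin (L.relArity R), Fin 1 => L.relDom R q.1) R
    fun j => .var (v := fun q : Σ _ : Fin (L.relArity R), Fin 1 => L.relDom R q.1) ⟨j, 0⟩
  fun_def
    | .inl f => ⟨fun _ => .app f fun j =>
        .var (v := fun q : Σ _ : Fin (L.funArity f), Fin 1 => L.funDom f q.1) ⟨j, 0⟩,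
        fun _ _ => rfl⟩
    | .inr E => ⟨fun j => .var (v := fun q : Σ _ : Fin E.arity, Fin 1 => E.dom q.1) ⟨j, 0⟩,
        fun _ _ => rfl⟩

/-- A property defined by one formula in the reducts is defined by one formula. -/
theorem UnifDef.of_reduct {ι : Type*} {𝓜 : ι → Structure L} {K : Sublanguage L} {α : Type}
    {v : α → K.toLanguage.Sorts} {P : ∀ i, Tuple ((𝓜 i).reduct K) v → Prop}
    (h : UnifDef (fun i => (𝓜 i).reduct K) v P) :
    UnifDef 𝓜 (fun a => (v a).1) P := by
  obtain ⟨φ, hφ⟩ := h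
  exact (((reductInterpretation 𝓜 K).unifDef_holds φ).subst (w := fun a => (v a).1)
    fun q => .var (v := fun a => (v a).1) q.1).congr hφ

/-- A definable property of tuples of `N` is definable in `N^eq`. -/
theorem UnifDef.to_eq {N : Structure L} {α : Type} {v : α → L.Sorts} {P : Tuple N v → Prop}
    (h : UnifDef (fun _ : Unit => N) v fun _ => P) :
    UnifDef (L := N.eqLanguage) (fun _ : Unit => N.eq) (fun a => .inl (v a)) fun _ => P := by
  obtain ⟨φ, hφ⟩ := h
  exact (((toEqInterpretation N).unifDef_holds φ).subst (L := N.eqLanguage)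
    (w := fun a => .inl (v a))
    fun q => Term.var (L := N.eqLanguage) (v := fun a => (Sum.inl (v a) : N.eqLanguage.Sorts)) q.1).congr hφ

end Instances

/-! ### Ultrapowers and Łoś's theorem -/

section Ultrapower

variable {L : Language.{u}} {I : Type u} (U : Ultrafilter I) (M : Structure L)

/-- The ultrapower of a many-sorted structure. -/
noncomputable def ultrapower : Structure L where
  carrier s := Filter.Germ (U : Filter I) (M.carrier s)
  nonempty s := ⟨((fun _ => (M.nonempty s).some : I → M.carrier s) :
    Filter.Germ (U : Filter I) (M.carrier s))⟩
  funMap f x := ((fun i => M.funMap f fun a => (x a).out i : I → M.carrier (L.funCod f)) :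
    Filter.Germ (U : Filter I) (M.carrier (L.funCod f)))
  relMap R x := ∀ᶠ i in (U : Filter I), M.relMap R fun a => (x a).out i

/-- The tuple of the ultrapower represented by a family of tuples. -/
def ultrapowerMk {α : Type} {v : α → L.Sorts} (g : I → Tuple M v) : Tuple (ultrapower U M) v :=
  fun a => ((fun i => g i a : I → M.carrier (v a)) : Filter.Germ (U : Filter I) (M.carrier (v a)))

theorem germ_out_eventuallyEq {X : Type u} (g : I → X) :
    Quotient.out (g : Filter.Germ (U : Filter I) X) =ᶠ[(U : Filter I)] g :=
  Filter.Germ.coe_eq.1 (Quotient.out_eq (g : Filter.Germ (U : Filter I) X))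

theorem ultrapower_eval {α : Type} {v : α → L.Sorts} (g : I → Tuple M v) {s : L.Sorts}
    (t : L.Term v s) :
    t.eval (ultrapower U M) (ultrapowerMk U M g) =
      ((fun i => t.eval M (g i) : I → M.carrier s) :
        Filter.Germ (U : Filter I) (M.carrier s)) := by
  induction t with
  | var a => rfl
  | app f ts ih =>
    refine Filter.Germ.coe_eq.2 ?_
    -- Arities are finite, so the representatives picked by `Quotient.out` agree with the given ones
    -- for all arguments simultaneously on a set in `U`.
    have : ∀ᶠ i in (U : Filter I), ∀ a, Quotient.out (((ts a).eval (ultrapower U M)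
        (ultrapowerMk U M g) : Filter.Germ (U : Filter I) (M.carrier (L.funDom f a)))) i =
          (ts a).eval M (g i) := by
      rw [Filter.eventually_all]
      intro a
      rw [ih a]
      exact germ_out_eventuallyEq U _
    filter_upwards [this] with i hi
    exact congrArg (M.funMap f) (funext hi)

theorem ultrapowerMk_append {α β : Type} {v : α → L.Sorts} {w : β → L.Sorts}
    (g : I → Tuple M v) (h : I → Tuple M w) :
    Tuple.append (ultrapowerMk U M g) (ultrapowerMk U M h) =
      ultrapowerMk U M fun i => (g i).append (h i) := by
  funext a
  cases a <;> rfl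

theorem ultrapowerMk_cons {s : L.Sorts} {Γ : List L.Sorts}
    (y : I → M.carrier s) (h : I → Tuple M Γ.get) :
    Tuple.cons (M := ultrapower U M) (y : Filter.Germ (U : Filter I) (M.carrier s))
      (ultrapowerMk U M h) = ultrapowerMk U M fun i => Tuple.cons (y i) (h i) := by
  funext j
  refine Fin.cases ?_ (fun j => ?_) j <;> rfl

/-- Łoś's theorem. -/
theorem ultrapower_realize {α : Type} {v : α → L.Sorts} {Γ : List L.Sorts}
    (φ : L.BoundedFormula v Γ) : ∀ (g : I → Tuple M v) (h : I → Tuple M Γ.get),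
    φ.Realize (ultrapower U M) (ultrapowerMk U M g) (ultrapowerMk U M h) ↔
      ∀ᶠ i in (U : Filter I), φ.Realize M (g i) (h i) := by
  induction φ with
  | falsum =>
    intro g h
    simp [BoundedFormula.Realize, U.neBot.ne]
  | equal t₁ t₂ =>
    intro g h
    simp only [BoundedFormula.Realize, ultrapowerMk_append, ultrapower_eval]
    exact Filter.Germ.coe_eq
  | rel R ts =>
    intro g h
    simp only [BoundedFormula.Realize, ultrapowerMk_append, ultrapower_eval]
    have : ∀ᶠ i in (U : Filter I), ∀ a, Quotient.out ((fun i => (ts a).eval M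
        ((g i).append (h i)) : I → M.carrier (L.relDom R a)) :
          Filter.Germ (U : Filter I) (M.carrier (L.relDom R a))) i =
            (ts a).eval M ((g i).append (h i)) := by
      rw [Filter.eventually_all]
      exact fun a => germ_out_eventuallyEq U _
    refine Filter.eventually_congr ?_
    filter_upwards [this] with i hi
    exact iff_of_eq (congrArg (M.relMap R) (funext hi))
  | imp φ ψ ihφ ihψ =>
    intro g h
    simp only [BoundedFormula.Realize, ihφ, ihψ]
    exact Ultrafilter.eventually_imp.symm
  | all s φ ih =>
    intro g h
    simp only [BoundedFormula.Realize]
    constructor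
    · intro H
      by_contra hcon
      rw [← Ultrafilter.eventually_not] at hcon
      have hne := M.nonempty s
      -- A counterexample is chosen wherever there is one, and an arbitrary element of the nonempty
      -- sort elsewhere.
      have : ∀ i, ∃ y : M.carrier s, (¬ ∀ a, φ.Realize M (g i) ((h i).cons a)) →
          ¬ φ.Realize M (g i) ((h i).cons y) := by
        intro i
        by_cases hi : ∀ a, φ.Realize M (g i) ((h i).cons a)
        · exact ⟨hne.some, fun h' => absurd hi h'⟩
        · obtain ⟨a, ha⟩ := not_forall.1 hi
          exact ⟨a, fun _ => ha⟩
      choose y hy using this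
      have := H (y : Filter.Germ (U : Filter I) (M.carrier s))
      rw [ultrapowerMk_cons, ih] at this
      obtain ⟨i, h1, h2⟩ := (this.and hcon).exists
      exact hy i h2 h1
    · intro H y
      induction y using Filter.Germ.inductionOn with
      | _ y =>
        rw [ultrapowerMk_cons, ih]
        filter_upwards [H] with i hi using hi (y i)

theorem ultrapower_holds {α : Type} {v : α → L.Sorts} (φ : L.Formula v) (g : I → Tuple M v) :
    φ.Holds (ultrapower U M) (ultrapowerMk U M g) ↔ ∀ᶠ i in (U : Filter I), φ.Holds M (g i) := by
  refine Iff.trans ?_ (ultrapower_realize U M φ g fun _ j => j.elim0)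
  exact iff_of_eq (congrArg (BoundedFormula.Realize (ultrapower U M) φ (ultrapowerMk U M g))
    (funext fun j : Fin 0 => j.elim0))

/-- The diagonal embedding. -/
noncomputable def ultrapowerEmbedding : ElementaryEmbedding M (ultrapower U M) where
  toFun s y := ((fun _ => y : I → M.carrier s) : Filter.Germ (U : Filter I) (M.carrier s))
  holds_iff _ φ x := (ultrapower_holds U M φ fun _ => x).trans Filter.eventually_const

end Ultrapower

/-! ### Uniform definitions in a stably embedded model -/

/-- If `M` is uniformly stably embedded in its elementary extensions, the sets that are finitely
approximable by instances of a fixed formula are the instances of another fixed formula. -/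
theorem exists_uniform_definition {L : Language.{u}} (M : Structure L)
    (hM : ∀ (M' : Structure L) (j : ElementaryEmbedding M M'), UniformlyStablyEmbedded M' j.range)
    {m : ℕ} (τ : Fin m → L.Sorts) {β : Type} [Finite β] (κ : β → L.Sorts)
    {P : Tuple M τ → Tuple M κ → Prop}
    (hP : UnifDef (fun _ : Unit => M) (Sum.elim τ κ) fun _ z =>
      P (fun a => z (.inl a)) (fun b => z (.inr b))) :
    ∃ (k : ℕ) (ρ : Fin k → L.Sorts) (χ : L.Formula (Sum.elim τ ρ)), ∀ X : Set (Tuple M τ),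
      (∀ F : Finset (Tuple M τ), ∃ y, ∀ t ∈ F, (t ∈ X ↔ P t y)) →
        ∃ b, ∀ t, t ∈ X ↔ χ.Holds₂ M t b := by
  classical
  obtain ⟨l, e, Φ, hΦ⟩ := UnifDef.exists_formula_fin
    (P := fun _ : Unit => P) hP
  let U : Ultrafilter (Finset (Tuple M τ)) := Ultrafilter.of Filter.atTop
  -- The ultrapower does not depend on `X`, and this makes `χ` uniform.
  obtain ⟨k, ρ, χ, hχ⟩ := hM _ (ultrapowerEmbedding U M) τ _ Φ
  refine ⟨k, ρ, χ, fun X hX => ?_⟩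
  choose y hy using hX
  -- The class of the approximating parameters `y F` defines `X` on the diagonal copy of `M`,
  -- because each t lies in almost every `F`.
  obtain ⟨a, ha, hax⟩ := hχ (ultrapowerMk U M fun F j => y F (e j))
  choose b hb using ha
  refine ⟨b, fun t => ?_⟩
  have ha' : a = ultrapowerMk U M fun _ => b := funext fun j => (hb j).symm
  have h1 := hax (ultrapowerMk U M fun _ => t) fun i => ⟨t i, rfl⟩
  rw [ha'] at h1
  simp only [Formula.Holds₂, ultrapowerMk_append, ultrapower_holds] at h1
  rw [Filter.eventually_const] at h1
  refine Iff.trans ?_ h1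
  have hF : ∀ᶠ F in (U : Filter (Finset (Tuple M τ))), t ∈ F :=
    Ultrafilter.of_le _ ((Filter.eventually_ge_atTop {t}).mono fun F hF =>
      Finset.singleton_subset_iff.1 hF)
  rw [← Filter.eventually_const (f := (U : Filter (Finset (Tuple M τ)))) (p := t ∈ X)]
  refine Filter.eventually_congr (hF.mono fun F htF => ?_)
  exact (hy F t htF).trans (hΦ () t (y F)).symm

open NIPCombinatorics

section Leaves

variable {L : Language.{u}} {α β γ : Type}

theorem UnifDef.holds₂ {ι : Type*} {𝓜 : ι → Structure L} {v : α → L.Sorts} {w : β → L.Sorts}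
    {s : γ → L.Sorts} (φ : L.Formula (Sum.elim v w)) (f : ∀ a, L.Term s (v a))
    (g : ∀ b, L.Term s (w b)) :
    UnifDef 𝓜 s fun i z => φ.Holds₂ (𝓜 i) (fun a => (f a).eval (𝓜 i) z)
      fun b => (g b).eval (𝓜 i) z := by
  refine ((UnifDef.formula φ).subst fun
    | .inl a => f a
    | .inr b => g b).congr fun i z => iff_of_eq (congrArg (φ.Holds (𝓜 i)) (funext fun a => ?_))
  cases a <;> rfl

theorem UnifDef.holds₂_reduct {ι : Type*} {𝓜 : ι → Structure L} {K : Sublanguage L}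
    {v : α → K.toLanguage.Sorts} {w : β → K.toLanguage.Sorts} {s : γ → L.Sorts}
    (φ : K.toLanguage.Formula (Sum.elim v w)) (f : ∀ a, L.Term s (v a).1)
    (g : ∀ b, L.Term s (w b).1) :
    UnifDef 𝓜 s fun i z => φ.Holds₂ ((𝓜 i).reduct K) (fun a => (f a).eval (𝓜 i) z)
      fun b => (g b).eval (𝓜 i) z := by
  refine ((UnifDef.formula φ).of_reduct.subst fun
    | .inl a => f a
    | .inr b => g b).congr fun i z =>
      iff_of_eq (congrArg (φ.Holds ((𝓜 i).reduct K)) (funext fun a => ?_))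
  cases a <;> rfl

theorem UnifDef.holds₂_reduct_eq {N : Structure L} {K : Sublanguage L}
    {v : α → K.toLanguage.Sorts} {w : β → K.toLanguage.Sorts} {s : γ → N.eqLanguage.Sorts}
    (φ : K.toLanguage.Formula (Sum.elim v w))
    (f : ∀ a, Language.Term N.eqLanguage s (Sum.inl (v a).1))
    (g : ∀ b, Language.Term N.eqLanguage s (Sum.inl (w b).1)) :
    UnifDef (fun _ : Unit => N.eq) s fun _ z => φ.Holds₂ (N.reduct K)
      (fun a => (f a).eval N.eq z) fun b => (g b).eval N.eq z := by
  refine (((UnifDef.formula (𝓜 := fun _ : Unit => N.reduct K) φ).of_reduct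
    (𝓜 := fun _ : Unit => N)).to_eq.subst (L := N.eqLanguage) fun
    | .inl a => f a
    | .inr b => g b).congr fun i z =>
      iff_of_eq (congrArg (φ.Holds (N.reduct K)) (funext fun a => ?_))
  cases a <;> rfl

end Leaves

theorem exists_not_shattersTuple {L : Language.{u}} {T : L.Theory} (hT : T.IsNIP) {M : Structure L}
    (hM : T.IsModel M) {n : ℕ} {σ : Fin n → L.Sorts} {β : Type} [Finite β] {κ : β → L.Sorts}
    {P : Tuple M σ → Tuple M κ → Prop}
    (hP : UnifDef (fun _ : Unit => M) (Sum.elim σ κ) fun _ z =>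
      P (fun a => z (.inl a)) (fun b => z (.inr b))) :
    ∃ d, ¬ ShattersTuple (fun y x => P x y) d := by
  obtain ⟨l, e, Φ, hΦ⟩ := UnifDef.exists_formula_fin (P := fun _ : Unit => P) hP
  obtain ⟨d, hd⟩ := hT M hM σ _ Φ
  refine ⟨d, fun ⟨a, ha⟩ => hd ⟨a, fun I => ?_⟩⟩
  obtain ⟨y, hy⟩ := ha I
  exact ⟨fun j => y (e j), fun i => (hΦ () (a i) y).trans (hy i)⟩

/-- In a model of an NIP theory that is uniformly stably embedded in its elementary extensions,
the definition of a sufficiently consistent `φ`-type is an instance of a fixed formula. -/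
theorem exists_uniform_definition_of_consistent {L : Language.{u}} {T : L.Theory} (hT : T.IsNIP)
    {M : Structure L} (hM : T.IsModel M)
    (hM' : ∀ (M' : Structure L) (j : ElementaryEmbedding M M'), UniformlyStablyEmbedded M' j.range)
    {n m : ℕ} {σ : Fin n → L.Sorts} {τ : Fin m → L.Sorts} (φ : L.Formula (Sum.elim σ τ)) :
    ∃ (d k : ℕ) (ρ : Fin k → L.Sorts) (χ : L.Formula (Sum.elim τ ρ)), ∀ Z : Set (Tuple M τ),
      Z.Nonempty → (∀ s : Fin d → Tuple M τ, ∃ x, ∀ i, φ.Holds₂ M x (s i) ↔ s i ∈ Z) →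
        ∃ b, ∀ t, t ∈ Z ↔ χ.Holds₂ M t b := by
  classical
  -- NIP is applied to φ with its variables exchanged, and then to the formula φ(x; t) ∧ ¬ φ(x; t').
  obtain ⟨d₁, h₁⟩ := exists_not_shattersTuple hT hM (σ := τ) (κ := σ)
    (P := fun t x => φ.Holds₂ M x t) (UnifDef.holds₂ φ
      (fun a => .var (v := Sum.elim τ σ) (.inr a)) fun b => .var (v := Sum.elim τ σ) (.inl b))
  obtain ⟨d₂, h₂⟩ := exists_not_shattersTuple hT hM (σ := σ) (κ := Sum.elim τ τ)
    (P := fun x y => φ.Holds₂ M x (fun b => y (.inl b)) ∧ ¬ φ.Holds₂ M x (fun b => y (.inr b)))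
    ((UnifDef.holds₂ φ (fun a => .var (v := Sum.elim σ (Sum.elim τ τ)) (.inl a))
        fun b => .var (v := Sum.elim σ (Sum.elim τ τ)) (.inr (.inl b))).and
      (UnifDef.holds₂ φ (fun a => .var (v := Sum.elim σ (Sum.elim τ τ)) (.inl a))
        fun b => .var (v := Sum.elim σ (Sum.elim τ τ)) (.inr (.inr b))).not)
  have hne : Nonempty (Tuple M σ) := ⟨fun i => (M.nonempty (σ i)).some⟩
  obtain ⟨d, l, hdl⟩ := exists_separation_bound (X := Tuple M σ) (Y := Tuple M τ)
    (fun x t => φ.Holds₂ M x t) d₁ d₂ h₁ (by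
      rintro ⟨a, ha⟩
      refine h₂ ⟨a, fun I => ?_⟩
      obtain ⟨q, hq⟩ := ha I
      exact ⟨Tuple.append q.1 q.2, hq⟩)
  let κ : (Fin l × Fin n) ⊕ (Set (Fin l) × Fin m) → L.Sorts :=
    Sum.elim (fun q => σ q.2) fun q => τ q.2
  -- The parameters are the separating points x_i and, for each pattern S ⊆ {1, …, l}, a point r_S
  -- of `Z`. The formula says that for some S, t satisfies every φ(x_i; ·) that r_S satisfies. A
  -- point of Z ∩ F passes with its own pattern, and a point of F \ Z fails because some x_i
  -- separates it from r_S.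
  obtain ⟨k, ρ, χ, hχ⟩ := exists_uniform_definition M hM' τ κ
    (P := fun t y => ∃ S : Set (Fin l), ∀ i : Fin l,
      φ.Holds₂ M (fun a => y (.inl (i, a))) (fun b => y (.inr (S, b))) →
        φ.Holds₂ M (fun a => y (.inl (i, a))) t)
    (UnifDef.exists_finite fun S => UnifDef.forall_finite fun i =>
      (UnifDef.holds₂ φ (fun a => .var (v := Sum.elim τ κ) (.inr (.inl (i, a))))
        fun b => .var (v := Sum.elim τ κ) (.inr (.inr (S, b)))).imp
      (UnifDef.holds₂ φ (fun a => .var (v := Sum.elim τ κ) (.inr (.inl (i, a))))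
        fun b => .var (v := Sum.elim τ κ) (.inl b)))
  refine ⟨d, k, ρ, χ, fun Z ⟨z, hz⟩ hZ => hχ Z fun F => ?_⟩
  obtain ⟨x, hx⟩ := hdl Z hZ (insert z F)
  -- For a pattern not realized in `Z` the default is `z`. This is harmless since `z` is in `Z`, and
  -- adding it to `F` ensures that it is separated too.
  have hrep : ∀ S : Set (Fin l), ∃ t ∈ insert z F, t ∈ Z ∧
      ((∃ t' ∈ insert z F, t' ∈ Z ∧ {i | φ.Holds₂ M (x i) t'} = S) →
        {i | φ.Holds₂ M (x i) t} = S) := by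
    intro S
    by_cases hS : ∃ t' ∈ insert z F, t' ∈ Z ∧ {i | φ.Holds₂ M (x i) t'} = S
    · obtain ⟨t', h, h', h''⟩ := hS
      exact ⟨t', h, h', fun _ => h''⟩
    · exact ⟨z, Finset.mem_insert_self _ _, hz, fun h => absurd h hS⟩
  choose r hrF hrZ hr using hrep
  refine ⟨fun
    | .inl q => x q.1 q.2
    | .inr q => r q.1 q.2, fun t ht => ⟨fun htZ => ?_, fun ⟨S, hS⟩ => ?_⟩⟩
  · refine ⟨{i | φ.Holds₂ M (x i) t}, fun i hi => ?_⟩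
    have := hr {i | φ.Holds₂ M (x i) t} ⟨t, Finset.mem_insert_of_mem ht, htZ, rfl⟩
    exact (Set.ext_iff.1 this i).1 hi
  · by_contra htZ
    obtain ⟨i, hi, hi'⟩ := hx (r S) (hrF S) t (Finset.mem_insert_of_mem ht) (hrZ S) htZ
    exact hi' (hS i hi)

/-! ### Transfer to arbitrary models of the complete theory -/

/-- A set of real tuples definable in `N^eq` is definable in `N`. -/
theorem Definable.exists_real_formula {L : Language.{u}} {N : Structure L}
    {A : (s : N.eqLanguage.Sorts) → Set (N.eq.carrier s)} {n : ℕ} {σ : Fin n → L.Sorts}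
    {X : Set (Tuple N σ)} (h : Definable N.eq A (fun i => Sum.inl (σ i)) X) :
    ∃ (β : Type) (_ : Finite β) (κ : β → L.Sorts) (θ : L.Formula (Sum.elim σ κ)) (c : Tuple N κ),
      ∀ t, t ∈ X ↔ θ.Holds₂ N t c := by
  obtain ⟨k, ρ, ψ, a, -, rfl⟩ := h
  let I := ofEqInterpretation N
  choose c hc using fun j => I.surj () (ρ j) (a j)
  obtain ⟨θ, hθ⟩ := (I.unifDef_holds ψ).subst (w := Sum.elim σ (I.expand ρ)) fun
    | ⟨.inl i, q⟩ => .var (v := Sum.elim σ (I.expand ρ)) (.inl i)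
    | ⟨.inr j, q⟩ => .var (v := Sum.elim σ (I.expand ρ)) (.inr ⟨j, q⟩)
  refine ⟨_, inferInstance, I.expand ρ, θ, fun q => c q.1 q.2, fun t => Iff.symm ?_⟩
  refine (hθ () _).trans (iff_of_eq (congrArg (ψ.Holds N.eq) (funext fun i => ?_)))
  rcases i with i | j
  · rfl
  · exact hc j

theorem Language.Theory.IsComplete.transfer {L : Language.{u}} {T : L.Theory} (hT : T.IsComplete)
    {M N : Structure L} (hM : T.IsModel M) (hN : T.IsModel N) {P : Structure L → Prop}
    (hP : UnifDef (fun K : Structure L => K) (Empty.elim : Empty → L.Sorts) fun K _ => P K)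
    (h : P M) : P N := by
  obtain ⟨φ, hφ⟩ := hP
  rcases hT.2 φ with h' | h'
  · exact (hφ N _).1 (h' N hN)
  · exact absurd ((hφ M _).2 h) (h' M hM)

theorem PhiType.exists_holds_iff_mem_defSet {L : Language.{u}} {M : Structure L} {n m : ℕ}
    {σ : Fin n → L.Sorts} {τ : Fin m → L.Sorts} {φ : L.Formula (Sum.elim σ τ)} (p : PhiType M φ)
    {J : Type*} [Finite J] (s : J → Tuple M τ) :
    ∃ x, ∀ i, φ.Holds₂ M x (s i) ↔ s i ∈ p.defSet := by
  -- The second component is a proposition, equal to `True` or `False` by extensionality. By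
  -- completeness of `p`, each pair belongs to `p`.
  obtain ⟨x, hx⟩ := p.consistent (Set.range fun i => (s i, s i ∈ p.defSet)) (by
    rintro _ ⟨i, rfl⟩
    by_cases h : s i ∈ p.defSet
    · simp only [h]
      exact h
    · simp only [h]
      exact (p.complete (s i)).resolve_left h) (Set.finite_range _)
  exact ⟨x, fun i => hx _ ⟨i, rfl⟩⟩

/-- In every model of `T'`, the definition of a `φ`-type is definable in the reduct by an instance
of an `L`-formula, as soon as it is definable. -/
theorem exists_reduct_definition {L' : Language.{u}} {L : Sublanguage L'}
    {T : L.toLanguage.Theory} {T' : L'.Theory} (hNIP : T.IsNIP) (hcomplete : T'.IsComplete)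
    (hsub : ∀ N : Structure L', T'.IsModel N → T.IsModel (N.reduct L))
    (hM : ∃ M : Structure L', T'.IsModel M ∧
      ∀ (M' : Structure L.toLanguage) (j : ElementaryEmbedding (M.reduct L) M'),
        UniformlyStablyEmbedded M' j.range)
    {n m : ℕ} {σ : Fin n → L.toLanguage.Sorts} {τ : Fin m → L.toLanguage.Sorts}
    {φ : L.toLanguage.Formula (Sum.elim σ τ)} {N : Structure L'} (hN : T'.IsModel N)
    (p : PhiType (N.reduct L) φ) (hne : p.defSet.Nonempty) {β : Type} [Finite β]
    {κ : β → L'.Sorts} (θ : L'.Formula (Sum.elim (fun i => (τ i).1) κ)) (c : Tuple N κ)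
    (hθ : ∀ t : Tuple (N.reduct L) τ, t ∈ p.defSet ↔ θ.Holds₂ N t c) :
    ∃ (k : ℕ) (ρ : Fin k → L.toLanguage.Sorts) (χ : L.toLanguage.Formula (Sum.elim τ ρ))
      (b : Tuple (N.reduct L) ρ), ∀ t, t ∈ p.defSet ↔ χ.Holds₂ (N.reduct L) t b := by
  obtain ⟨M, hMT, hMU⟩ := hM
  obtain ⟨d, k, ρ, χ, hχ⟩ := exists_uniform_definition_of_consistent hNIP (hsub M hMT) hMU φ
  let τs : Fin d × Fin m → L'.Sorts := fun q => (τ q.2).1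
  -- Consistency on `d` points is all that `hχ` requires, so this is a first-order property of `K`.
  -- Quantifying over all `a` removes the parameters.
  let P : Structure L' → Prop := fun K => ∀ a : Tuple K κ,
    (∀ s : Tuple K τs, ∃ x : Tuple K (fun i => (σ i).1), ∀ i : Fin d,
      (φ.Holds₂ (K.reduct L) x (fun b => s (i, b)) ↔ θ.Holds₂ K (fun b => s (i, b)) a)) →
    (∃ t : Tuple K (fun i => (τ i).1), θ.Holds₂ K t a) →
      ∃ b : Tuple K (fun i => (ρ i).1), ∀ t : Tuple K (fun i => (τ i).1),
        (θ.Holds₂ K t a ↔ χ.Holds₂ (K.reduct L) t b)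
  have hP : UnifDef (fun K : Structure L' => K) (Empty.elim : Empty → L'.Sorts) fun K _ => P K := by
    refine UnifDef.all (UnifDef.imp ?_ (UnifDef.imp ?_ ?_))
    · refine UnifDef.all (UnifDef.exists' (UnifDef.forall_finite fun i => UnifDef.iff ?_ ?_))
      · exact UnifDef.holds₂_reduct φ (fun a => .var (v := Sum.elim (Sum.elim (Sum.elim
          (Empty.elim : Empty → L'.Sorts) κ) τs) fun i => (σ i).1) (.inr a))
          fun b => .var (v := Sum.elim (Sum.elim (Sum.elim
          (Empty.elim : Empty → L'.Sorts) κ) τs) fun i => (σ i).1) (.inl (.inr (i, b)))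
      · exact UnifDef.holds₂ θ (fun a => .var (v := Sum.elim (Sum.elim (Sum.elim
          (Empty.elim : Empty → L'.Sorts) κ) τs) fun i => (σ i).1) (.inl (.inr (i, a))))
          fun b => .var (v := Sum.elim (Sum.elim (Sum.elim
          (Empty.elim : Empty → L'.Sorts) κ) τs) fun i => (σ i).1) (.inl (.inl (.inr b)))
    · refine UnifDef.exists' ?_
      exact UnifDef.holds₂ θ
        (fun a => .var (v := Sum.elim (Sum.elim (Empty.elim : Empty → L'.Sorts) κ)
          fun i => (τ i).1) (.inr a))
        fun b => .var (v := Sum.elim (Sum.elim (Empty.elim : Empty → L'.Sorts) κ)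
          fun i => (τ i).1) (.inl (.inr b))
    · refine UnifDef.exists' (UnifDef.all (UnifDef.iff ?_ ?_))
      · exact UnifDef.holds₂ θ
          (fun a => .var (v := Sum.elim (Sum.elim (Sum.elim (Empty.elim : Empty → L'.Sorts) κ)
            fun i => (ρ i).1) fun i => (τ i).1) (.inr a))
          fun b => .var (v := Sum.elim (Sum.elim (Sum.elim (Empty.elim : Empty → L'.Sorts) κ)
            fun i => (ρ i).1) fun i => (τ i).1) (.inl (.inl (.inr b)))
      · exact UnifDef.holds₂_reduct χ
          (fun a => .var (v := Sum.elim (Sum.elim (Sum.elim (Empty.elim : Empty → L'.Sorts) κ)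
            fun i => (ρ i).1) fun i => (τ i).1) (.inr a))
          fun b => .var (v := Sum.elim (Sum.elim (Sum.elim (Empty.elim : Empty → L'.Sorts) κ)
            fun i => (ρ i).1) fun i => (τ i).1) (.inl (.inr b))
  have hPM : P M := fun a hcons ht =>
    hχ {t | θ.Holds₂ M t a} ht fun s => hcons fun q => s q.1 q.2
  obtain ⟨b, hb⟩ := hcomplete.transfer hMT hN hP hPM c (fun s => by
    obtain ⟨x, hx⟩ := p.exists_holds_iff_mem_defSet fun (i : Fin d) (b : Fin m) => s (i, b)
    exact ⟨x, fun i => (hx i).trans (hθ _)⟩) (by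
    obtain ⟨t, ht⟩ := hne
    exact ⟨t, (hθ t).1 ht⟩)
  exact ⟨k, ρ, χ, b, fun t => (hθ t).trans (hb t)⟩

end ManySorted

/-! ### Descent of the parameters by elimination of imaginaries -/

theorem mainTheorem1
    (L' : ManySorted.Language.{u}) (L : ManySorted.Sublanguage L')
    (T : L.toLanguage.Theory) (T' : L'.Theory)
    (hNIP : T.IsNIP) (hEI : T.EliminatesImaginaries)
    (hcomplete : T'.IsComplete)
    (hsub : ∀ N : ManySorted.Structure L', T'.IsModel N → T.IsModel (N.reduct L))
    (hM : ∃ M : ManySorted.Structure L', T'.IsModel M ∧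
      ∀ (M' : ManySorted.Structure L.toLanguage)
        (j : ManySorted.ElementaryEmbedding (M.reduct L) M'),
        ManySorted.UniformlyStablyEmbedded M' j.range)
    {n m : ℕ} (σ : Fin n → L.toLanguage.Sorts) (τ : Fin m → L.toLanguage.Sorts)
    (φ : L.toLanguage.Formula (Sum.elim σ τ))
    (N : ManySorted.Structure L') (hN : T'.IsModel N)
    (A : (s : N.eqLanguage.Sorts) → Set (N.eq.carrier s))
    (hA : A = ManySorted.dcl N.eq A)
    (p : ManySorted.PhiType (N.reduct L) φ)
    (hp : ManySorted.Definable N.eq A (fun i => Sum.inl (τ i).1) p.defSet) :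
    ManySorted.Definable (N.reduct L) (ManySorted.realPart L A) τ p.defSet := by
  open ManySorted ManySorted.Language in
  -- The uniform definition is available only for nonempty sets. The empty one needs no parameters.
  rcases p.defSet.eq_empty_or_nonempty with h0 | hne
  · exact ⟨0, fun i => i.elim0, .falsum, fun i => i.elim0, fun i => i.elim0, h0⟩
  obtain ⟨β, hβ, κ, θ, c, hθ⟩ := Definable.exists_real_formula (L := L') hp
  obtain ⟨k, ρ, χ, b, hb⟩ := exists_reduct_definition hNIP hcomplete hsub hM hN p hne θ c hθ
  obtain ⟨l, ω, ψ, a, haA, hψ⟩ := hp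
  -- `E` relates parameters that give the same instance of `χ`, so the class of `b` depends only on
  -- the set defined by `p`.
  obtain ⟨E, hE⟩ : UnifDef (fun _ : Unit => N.reduct L) (Sum.elim ρ ρ) fun _ z =>
      ∀ t : Tuple (N.reduct L) τ, (χ.Holds₂ (N.reduct L) t (fun j => z (.inl j)) ↔
        χ.Holds₂ (N.reduct L) t fun j => z (.inr j)) :=
    UnifDef.all (UnifDef.iff
      (UnifDef.holds₂ χ (fun i => .var (v := Sum.elim (Sum.elim ρ ρ) τ) (.inr i))
        fun j => .var (v := Sum.elim (Sum.elim ρ ρ) τ) (.inl (.inl j)))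
      (UnifDef.holds₂ χ (fun i => .var (v := Sum.elim (Sum.elim ρ ρ) τ) (.inr i))
        fun j => .var (v := Sum.elim (Sum.elim ρ ρ) τ) (.inl (.inr j))))
  have hE' : ∀ x y : Tuple (N.reduct L) ρ, E.Holds₂ (N.reduct L) x y ↔
      ∀ t, χ.Holds₂ (N.reduct L) t x ↔ χ.Holds₂ (N.reduct L) t y :=
    fun x y => hE () (x.append y)
  obtain ⟨r, ν, ξ, e, he, hu⟩ := hEI (N.reduct L) (hsub N hN) ρ E
    ⟨fun x => (hE' x x).2 fun t => Iff.rfl,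
      fun h => (hE' _ _).2 fun t => ((hE' _ _).1 h t).symm,
      fun h h' => (hE' _ _).2 fun t => ((hE' _ _).1 h t).trans ((hE' _ _).1 h' t)⟩ b
  -- The class is expressed through `ψ` and its parameters `a` from `A`, without mention of `b`.
  have hclass : ∀ y, E.Holds₂ (N.reduct L) y b ↔
      ∀ t, (χ.Holds₂ (N.reduct L) t y ↔ ψ.Holds₂ N.eq t a) := fun y => by
    rw [hE']
    exact forall_congr' fun t => iff_congr Iff.rfl
      ((hb t).symm.trans (Set.ext_iff.1 hψ t))
  have hcode : ∀ e' : Tuple (N.reduct L) ν,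
      (∀ y, ξ.Holds₂ (N.reduct L) y e' ↔
        ∀ t, (χ.Holds₂ (N.reduct L) t y ↔ ψ.Holds₂ N.eq t a)) ↔ e' = e := by
    refine fun e' => ⟨fun h => hu e' (Set.ext fun y => (h y).trans (hclass y).symm), ?_⟩
    rintro rfl y
    exact (Set.ext_iff.1 he y).trans (hclass y)
  obtain ⟨ζ, hζ⟩ : UnifDef (fun _ : Unit => N.reduct L) (Sum.elim τ ν) fun _ z =>
      ∃ y : Tuple (N.reduct L) ρ, ξ.Holds₂ (N.reduct L) y (fun j => z (.inr j)) ∧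
        χ.Holds₂ (N.reduct L) (fun i => z (.inl i)) y :=
    UnifDef.exists' (UnifDef.and
      (UnifDef.holds₂ ξ (fun i => .var (v := Sum.elim (Sum.elim τ ν) ρ) (.inr i))
        fun j => .var (v := Sum.elim (Sum.elim τ ν) ρ) (.inl (.inr j)))
      (UnifDef.holds₂ χ (fun i => .var (v := Sum.elim (Sum.elim τ ν) ρ) (.inl (.inl i)))
        fun j => .var (v := Sum.elim (Sum.elim τ ν) ρ) (.inr j)))
  refine ⟨r, ν, ζ, e, fun i => ?_, Set.ext fun t => Iff.trans ?_ (hζ () (t.append e)).symm⟩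
  · refine (congrArg (fun S => e i ∈ S) (congrFun hA (Sum.inl (ν i).1))).mpr ?_
    let ν' : Fin r → N.eqLanguage.Sorts := fun j => Sum.inl (ν j).1
    let ρ' : Fin k → N.eqLanguage.Sorts := fun j => Sum.inl (ρ j).1
    let τ' : Fin m → N.eqLanguage.Sorts := fun j => Sum.inl (τ j).1
    let v₀ : Fin 1 ⊕ Fin l → N.eqLanguage.Sorts := Sum.elim (fun _ => ν' i) ω
    -- By `hcode`, `e` is the only tuple coding the class, so "being the `i`-th entry of a code"
    -- defines `e i` over `a`.
    obtain ⟨η, hη⟩ : UnifDef (L := N.eqLanguage) (fun _ : Unit => N.eq) v₀ fun _ z =>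
        ∃ e' : Tuple N.eq ν', e' i = z (.inl 0) ∧ ∀ y : Tuple N.eq ρ',
          (ξ.Holds₂ (N.reduct L) y e' ↔ ∀ t : Tuple N.eq τ',
            (χ.Holds₂ (N.reduct L) t y ↔ ψ.Holds₂ N.eq t fun j => z (.inr j))) := by
      refine UnifDef.exists' (UnifDef.and ?_ (UnifDef.all (UnifDef.iff ?_
        (UnifDef.all (UnifDef.iff ?_ ?_)))))
      · exact UnifDef.eq (L := N.eqLanguage) (v := Sum.elim v₀ ν')
          (Term.var (L := N.eqLanguage) (v := Sum.elim v₀ ν') (.inr i))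
          (Term.var (L := N.eqLanguage) (v := Sum.elim v₀ ν') (.inl (.inl 0)))
      · exact UnifDef.holds₂_reduct_eq ξ
          (fun j => Term.var (L := N.eqLanguage) (v := Sum.elim (Sum.elim v₀ ν') ρ') (.inr j))
          fun j => Term.var (L := N.eqLanguage) (v := Sum.elim (Sum.elim v₀ ν') ρ')
            (.inl (.inr j))
      · exact UnifDef.holds₂_reduct_eq χ
          (fun j => Term.var (L := N.eqLanguage)
            (v := Sum.elim (Sum.elim (Sum.elim v₀ ν') ρ') τ') (.inr j))
          fun j => Term.var (L := N.eqLanguage)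
            (v := Sum.elim (Sum.elim (Sum.elim v₀ ν') ρ') τ') (.inl (.inr j))
      · exact UnifDef.holds₂ (L := N.eqLanguage) ψ
          (fun j => Term.var (L := N.eqLanguage)
            (v := Sum.elim (Sum.elim (Sum.elim v₀ ν') ρ') τ') (.inr j))
          fun j => Term.var (L := N.eqLanguage)
            (v := Sum.elim (Sum.elim (Sum.elim v₀ ν') ρ') τ') (.inl (.inl (.inl (.inr j))))
    refine ⟨l, ω, η, a, haA, Set.ext fun x => Iff.symm ((hη () _).trans ⟨?_, fun hx => ?_⟩)⟩
    · rintro ⟨e', he', h⟩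
      have := (hcode e').1 h
      subst this
      exact he'.symm
    · exact ⟨e, hx.symm, (hcode e).2 rfl⟩
  -- All members y of the class coded by `e` give the same set χ(·; y), so it does not matter which
  -- one witnesses `ζ`.
  · rw [hb t]
    constructor
    · intro h
      exact ⟨b, (Set.ext_iff.1 he b).2 ((hE' b b).2 fun t => Iff.rfl), h⟩
    · rintro ⟨y, hy, h⟩
      exact ((hE' y b).1 ((Set.ext_iff.1 he y).1 hy) t).1 h
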